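/- Let $k$ be a field and let $q\in k$ be a nonzero element of infinite multiplicative order. Let $$\Lambda=k\langle x,y,z\rangle/(x^2,\;y^2,\;z^2,\;zy,\;yx+qxy,\;zx-xz,\;yz-xz),$$ and let $M(q)$ be the three-dimensional right $\Lambda$-module with basis $v,v',v''$ on which $vx=qv'$, $vy=v'$, $vz=v''$, and $v',v''$ are annihilated by $x,y,z$. Let $$\Lambda[M(q)]=\begin{pmatrix}k&M(q)\\0&\Lambda\end{pmatrix}$$ be the one-point extension algebra, and let $A=\Lambda[M(q)]^{op}$ be its opposite algebra. Let $\mathcal D(A)$ be the unbounded derived category of the category of all right $A$-modules, and let $\operatorname{Loc}(\operatorname{Inj}A)$ be the localizing subcategory of $\mathcal D(A)$ generated by the injective right $A$-modules (regarded as complexes concentrated in degree $0$), i.e. the smallest full triangulated subcategory of $\mathcal D(A)$ that contains them and is closed under isomorphisms and arbitrary set-indexed coproducts. **Proposition.** Injectives generate for $A=\Lambda[M(q)]^{op}$; that is, $$\mathcal D(A)=\operatorname{Loc}(\operatorname{Inj}A).$$ -/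

import Mathlib

open CategoryTheory

universe w u

noncomputable section

/-! ### The algebra `Λ(q)` -/

/-- Names of the three generators `x, y, z`. -/
inductive RZGen : Type
  | x | y | z

/-- The defining relations of `Λ(q)` in the free algebra `k⟨x, y, z⟩`. -/
inductive RZRel (k : Type u) [Field k] (q : k) :
    FreeAlgebra k RZGen → FreeAlgebra k RZGen → Prop
  | xx : RZRel k q (FreeAlgebra.ι k RZGen.x * FreeAlgebra.ι k RZGen.x) 0
  | yy : RZRel k q (FreeAlgebra.ι k RZGen.y * FreeAlgebra.ι k RZGen.y) 0
  | zz : RZRel k q (FreeAlgebra.ι k RZGen.z * FreeAlgebra.ι k RZGen.z) 0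
  | zy : RZRel k q (FreeAlgebra.ι k RZGen.z * FreeAlgebra.ι k RZGen.y) 0
  | yx : RZRel k q (FreeAlgebra.ι k RZGen.y * FreeAlgebra.ι k RZGen.x +
      q • (FreeAlgebra.ι k RZGen.x * FreeAlgebra.ι k RZGen.y)) 0
  | zx : RZRel k q (FreeAlgebra.ι k RZGen.z * FreeAlgebra.ι k RZGen.x -
      FreeAlgebra.ι k RZGen.x * FreeAlgebra.ι k RZGen.z) 0
  | yz : RZRel k q (FreeAlgebra.ι k RZGen.y * FreeAlgebra.ι k RZGen.z -
      FreeAlgebra.ι k RZGen.x * FreeAlgebra.ι k RZGen.z) 0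

/-- `Λ(q) = k⟨x, y, z⟩ / (x², y², z², zy, yx + qxy, zx - xz, yz - xz)`. -/
def RZAlgebra (k : Type u) [Field k] (q : k) : Type u := RingQuot (RZRel k q)

namespace RZAlgebra

variable (k : Type u) [Field k] (q : k)

instance : Ring (RZAlgebra k q) := inferInstanceAs (Ring (RingQuot (RZRel k q)))

instance : Algebra k (RZAlgebra k q) := inferInstanceAs (Algebra k (RingQuot (RZRel k q)))

/-- The image in `Λ(q)` of a generator. -/
def gen (i : RZGen) : RZAlgebra k q := RingQuot.mkAlgHom k (RZRel k q) (FreeAlgebra.ι k i)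

end RZAlgebra

/-! ### The right modules `M(α)` -/

/-- The matrices by which `x, y, z` act on row vectors with respect to the basis `v, v', v''`:
`vx = αv'`, `vy = v'`, `vz = v''`, and everything else is zero. -/
def RZModule.genMatrix {k : Type u} [Field k] (α : k) : RZGen → Matrix (Fin 3) (Fin 3) k
  | .x => !![0, α, 0; 0, 0, 0; 0, 0, 0]
  | .y => !![0, 1, 0; 0, 0, 0; 0, 0, 0]
  | .z => !![0, 0, 1; 0, 0, 0; 0, 0, 0]

/-- The representation `Λ(q) → Mat₃(k)` (acting on row vectors from the right) that
defines `M(α)`. -/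
def RZModule.rep {k : Type u} [Field k] (q α : k) :
    RZAlgebra k q →ₐ[k] Matrix (Fin 3) (Fin 3) k :=
  RingQuot.liftAlgHom k ⟨FreeAlgebra.lift k (RZModule.genMatrix α), by
    intro a b h
    cases h <;>
    · ext i j
      fin_cases i <;> fin_cases j <;>
        simp [RZModule.genMatrix, Matrix.mul_apply, Fin.sum_univ_three]⟩

/-- The three-dimensional right `Λ(q)`-module `M(α)`, whose underlying space is the space of
row vectors `k³`, with basis `v, v', v''` the standard basis. -/
def RZModule (k : Type u) [Field k] (_q _α : k) : Type u := Fin 3 → k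

namespace RZModule

variable (k : Type u) [Field k] (q α : k)

instance : AddCommGroup (RZModule k q α) := inferInstanceAs (AddCommGroup (Fin 3 → k))

instance : Module k (RZModule k q α) := inferInstanceAs (Module k (Fin 3 → k))

/-- Right `Λ(q)`-modules are modules over `Λ(q)ᵐᵒᵖ`. -/
instance : Module (RZAlgebra k q)ᵐᵒᵖ (RZModule k q α) :=
  Module.compHom (Fin 3 → k) (RingHom.op (rep q α).toRingHom)

theorem op_smul_eq (a : RZAlgebra k q) (m : RZModule k q α) :
    MulOpposite.op a • m = (Matrix.vecMul (m : Fin 3 → k) (rep q α a) : Fin 3 → k) := rfl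

theorem rep_gen (i : RZGen) : rep q α (RZAlgebra.gen k q i) = genMatrix α i :=
  (RingQuot.liftAlgHom_mkAlgHom_apply k _ _ _).trans (FreeAlgebra.lift_ι_apply _ _)

instance : SMulCommClass k (RZAlgebra k q)ᵐᵒᵖ (RZModule k q α) where
  smul_comm c a m := (Matrix.smul_vecMul c (m : Fin 3 → k) (rep q α a.unop)).symm

instance : IsScalarTower k (RZAlgebra k q)ᵐᵒᵖ (RZModule k q α) where
  smul_assoc c a m := by
    change Matrix.vecMul (m : Fin 3 → k) (rep q α (c • a.unop)) =
      c • Matrix.vecMul (m : Fin 3 → k) (rep q α a.unop)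
    rw [map_smul]
    exact Matrix.vecMul_smul _ c _

end RZModule

/-! ### One-point extensions -/

/-- The one-point extension `A[M]` of a `k`-algebra `A` by a right `A`-module `M`: the algebra of
matrices `(c m; 0 a)` with `c : k`, `m : M` and `a : A`. -/
@[ext]
structure OnePointExtension (k A M : Type u) : Type u where
  /-- the upper left entry -/
  c : k
  /-- the upper right entry -/
  m : M
  /-- the lower right entry -/
  a : A

namespace OnePointExtension

variable {k A M : Type u} [Field k] [Ring A] [AddCommGroup M]

instance : Zero (OnePointExtension k A M) := ⟨⟨0, 0, 0⟩⟩
instance : One (OnePointExtension k A M) := ⟨⟨1, 0, 1⟩⟩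
instance : Add (OnePointExtension k A M) := ⟨fun s t => ⟨s.c + t.c, s.m + t.m, s.a + t.a⟩⟩
instance : Neg (OnePointExtension k A M) := ⟨fun s => ⟨-s.c, -s.m, -s.a⟩⟩

@[simp] theorem zero_c : (0 : OnePointExtension k A M).c = 0 := rfl
@[simp] theorem zero_m : (0 : OnePointExtension k A M).m = 0 := rfl
@[simp] theorem zero_a : (0 : OnePointExtension k A M).a = 0 := rfl
@[simp] theorem one_c : (1 : OnePointExtension k A M).c = 1 := rfl
@[simp] theorem one_m : (1 : OnePointExtension k A M).m = 0 := rfl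
@[simp] theorem one_a : (1 : OnePointExtension k A M).a = 1 := rfl
@[simp] theorem add_c (s t : OnePointExtension k A M) : (s + t).c = s.c + t.c := rfl
@[simp] theorem add_m (s t : OnePointExtension k A M) : (s + t).m = s.m + t.m := rfl
@[simp] theorem add_a (s t : OnePointExtension k A M) : (s + t).a = s.a + t.a := rfl
@[simp] theorem neg_c (s : OnePointExtension k A M) : (-s).c = -s.c := rfl
@[simp] theorem neg_m (s : OnePointExtension k A M) : (-s).m = -s.m := rfl
@[simp] theorem neg_a (s : OnePointExtension k A M) : (-s).a = -s.a := rfl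

variable [Module k M] [Module Aᵐᵒᵖ M]

/-- Matrix multiplication: `(c m; 0 a) (c' m'; 0 a') = (cc' cm' + ma'; 0 aa')`. -/
instance : Mul (OnePointExtension k A M) :=
  ⟨fun s t => ⟨s.c * t.c, s.c • t.m + MulOpposite.op t.a • s.m, s.a * t.a⟩⟩

@[simp] theorem mul_c (s t : OnePointExtension k A M) : (s * t).c = s.c * t.c := rfl
@[simp] theorem mul_m (s t : OnePointExtension k A M) :
    (s * t).m = s.c • t.m + MulOpposite.op t.a • s.m := rfl
@[simp] theorem mul_a (s t : OnePointExtension k A M) : (s * t).a = s.a * t.a := rfl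

instance [SMulCommClass k Aᵐᵒᵖ M] : Ring (OnePointExtension k A M) where
  add_assoc _ _ _ := by ext <;> simp [add_assoc]
  zero_add _ := by ext <;> simp
  add_zero _ := by ext <;> simp
  add_comm _ _ := by ext <;> simp [add_comm]
  neg_add_cancel _ := by ext <;> simp
  nsmul := nsmulRec
  zsmul := zsmulRec
  left_distrib _ _ _ := by ext <;> simp [mul_add, add_smul]; abel
  right_distrib _ _ _ := by ext <;> simp [add_mul, add_smul]; abel
  zero_mul _ := by ext <;> simp
  mul_zero _ := by ext <;> simp
  mul_assoc r s t := by
    ext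
    · simp [mul_assoc]
    · simp only [mul_m, mul_c, mul_a, smul_add, mul_smul, MulOpposite.op_mul, add_assoc]
      rw [smul_comm r.c (MulOpposite.op t.a) s.m]
    · simp [mul_assoc]
  one_mul _ := by ext <;> simp
  mul_one _ := by ext <;> simp

/-- The `k`-algebra structure: `c` acts as the scalar matrix `(c 0; 0 c)`. -/
instance [Algebra k A] [SMulCommClass k Aᵐᵒᵖ M] [IsScalarTower k Aᵐᵒᵖ M] :
    Algebra k (OnePointExtension k A M) :=
  RingHom.toAlgebra'
    { toFun := fun c => ⟨c, 0, algebraMap k A c⟩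
      map_zero' := by ext <;> simp
      map_one' := by ext <;> simp
      map_add' := fun _ _ => by ext <;> simp
      map_mul' := fun _ _ => by ext <;> simp }
    (fun c s => by
      have h : MulOpposite.op (algebraMap k A c) • s.m = c • s.m := by
        rw [Algebra.algebraMap_eq_smul_one, MulOpposite.op_smul, smul_assoc, MulOpposite.op_one,
          one_smul]
      ext
      · exact mul_comm _ _
      · simp [h]
      · exact Algebra.commutes _ _)

end OnePointExtension

/-! ### Injective generation -/

/-- A localizing subcategory of a triangulated category, as a property of objects: a full
triangulated subcategory, closed under isomorphisms and all (`u`-small) coproducts that exist. -/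
class IsLocalizingSubcategory {T : Type*} [Category* T] [Limits.HasZeroObject T]
    [HasShift T ℤ] [Preadditive T] [∀ n : ℤ, (shiftFunctor T n).Additive] [Pretriangulated T]
    (P : ObjectProperty T) : Prop extends P.IsTriangulated, P.IsClosedUnderIsomorphisms where
  coproducts (ι : Type u) : P.IsClosedUnderColimitsOfShape (Discrete ι)

/-- The localizing subcategory `Loc(S)` generated by a class `S` of objects: the intersection of
all localizing subcategories that contain `S`. -/
def localizingClosure {T : Type*} [Category* T] [Limits.HasZeroObject T]
    [HasShift T ℤ] [Preadditive T] [∀ n : ℤ, (shiftFunctor T n).Additive] [Pretriangulated T]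
    (S : ObjectProperty T) : ObjectProperty T :=
  fun X => ∀ P : ObjectProperty T, IsLocalizingSubcategory.{u} P → S ≤ P → P X

/-- The objects of the derived category `D(R)` of right `R`-modules that are isomorphic to an
injective right `R`-module placed in degree `0`. -/
def injectiveModules (R : Type u) [Ring R] [HasDerivedCategory.{w} (ModuleCat.{u} Rᵐᵒᵖ)] :
    ObjectProperty (DerivedCategory (ModuleCat.{u} Rᵐᵒᵖ)) :=
  (isInjective (ModuleCat.{u} Rᵐᵒᵖ)).map (DerivedCategory.singleFunctor (ModuleCat.{u} Rᵐᵒᵖ) 0)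

/-- Injectives generate for `R`: every object of the unbounded derived category `D(R)` of right
`R`-modules lies in `Loc(Inj R)`. -/
def InjectivesGenerate (R : Type u) [Ring R]
    [HasDerivedCategory.{w} (ModuleCat.{u} Rᵐᵒᵖ)] : Prop :=
  localizingClosure.{u} (injectiveModules.{w} R) = ⊤

end

/-! Write `B` for the one-point extension. Right modules over `Bᵐᵒᵖ` are left `B`-modules, so the
task is to show that a localizing subcategory `P` of the derived category of left `B`-modules that
contains the injectives contains everything.

Reduction to modules: the cycles and boundaries of any complex, bounded or not, give complexes with
zero differential, which are coproducts of shifted modules (`prop_of_forall_modules`). This needs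
the localization functor to preserve coproducts (`nonempty_isColimit_Q_cofan`). Modules in `P`
satisfy two-out-of-three in short exact sequences and are closed under direct sums. Moreover, if `d`
is an endomorphism of a module in `P` with kernel equal to its image, this image is in `P`: it is
resolved by `⋯ → F → F`, the telescope of its truncations (`modules_range_of_ker_eq_range`).

The modules: `B` has two simple modules, `S` at `Λ` and `T` at the extension vertex. The dual of `Λ`
is an injective `B`-module, and precomposition with left multiplication by `x` is an exact
differential on it, because the right annihilator of `x` is `xΛ`. Its image is the dual of `M(0) =
Λ/xΛ`, with simple socle `S` and top `S²`. A countable direct sum of copies has an exact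
differential identifying the whole top with the whole socle, so `S^(ℕ)`, and hence `S`, is in `P`
(`class_sndAug`). The remaining injective has socle `T`, and its quotient by `T` is the dual of
`M(q)`, an iterated extension of copies of `S`; so `T` is in `P` (`class_fst`). Finally every module
has a finite filtration whose layers are sums of copies of `S` or of `T`
(`class_of_isLocalizingModuleClass`). -/

noncomputable section

open CategoryTheory Limits

/-! ### Quasi-isomorphisms of complexes of modules and their coproducts. -/

namespace ModuleCat

variable {R : Type u} [Ring R]

/-- A morphism of short complexes of modules is a quasi-isomorphism iff it is bijective on
homology classes, in terms of elements. -/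
theorem shortComplex_quasiIso_iff {S T : ShortComplex (ModuleCat.{u} R)} (φ : S ⟶ T) :
    ShortComplex.QuasiIso φ ↔
      (∀ x : S.X₂, S.g x = 0 → (∃ y : T.X₁, T.f y = φ.τ₂ x) → ∃ z : S.X₁, S.f z = x) ∧
      (∀ y : T.X₂, T.g y = 0 → ∃ x : S.X₂, S.g x = 0 ∧ ∃ z : T.X₁, y = φ.τ₂ x + T.f z) := by
  have h23 : ∀ x, T.g (φ.τ₂ x) = φ.τ₃ (S.g x) := fun x => by
    rw [← ConcreteCategory.comp_apply, ← ConcreteCategory.comp_apply, φ.comm₂₃]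
  have h12 : ∀ x, T.f (φ.τ₁ x) = φ.τ₂ (S.f x) := fun x => by
    rw [← ConcreteCategory.comp_apply, ← ConcreteCategory.comp_apply, φ.comm₁₂]
  let k : LinearMap.ker S.g.hom →ₗ[R] LinearMap.ker T.g.hom :=
    φ.τ₂.hom.restrict (fun x hx => by
      rw [LinearMap.mem_ker] at hx ⊢
      exact (h23 x).trans (by rw [show S.g x = 0 from hx, map_zero]))
  let h : (LinearMap.ker S.g.hom ⧸ LinearMap.range S.moduleCatToCycles) →ₗ[R]
      (LinearMap.ker T.g.hom ⧸ LinearMap.range T.moduleCatToCycles) :=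
    Submodule.mapQ _ _ k (by
      rintro _ ⟨x, rfl⟩
      exact ⟨φ.τ₁ x, Subtype.ext (h12 x)⟩)
  let γ : ShortComplex.LeftHomologyMapData φ S.moduleCatLeftHomologyData
      T.moduleCatLeftHomologyData :=
    { φK := ModuleCat.ofHom k
      φH := ModuleCat.ofHom h
      commi := rfl
      commf' := by
        ext x
        exact Subtype.ext (h12 x).symm
      commπ := rfl }
  rw [γ.quasiIso_iff, ConcreteCategory.isIso_iff_bijective]
  refine and_congr ?_ ?_
  · change Function.Injective h ↔ _
    rw [injective_iff_map_eq_zero]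
    constructor
    · rintro H x hx ⟨y, hy⟩
      have := H (Submodule.Quotient.mk ⟨x, hx⟩) (by
        refine (Submodule.Quotient.mk_eq_zero _).2 ⟨y, Subtype.ext hy⟩)
      obtain ⟨z, hz⟩ := (Submodule.Quotient.mk_eq_zero _).1 this
      exact ⟨z, congrArg Subtype.val hz⟩
    · intro H a ha
      obtain ⟨⟨x, hx⟩, rfl⟩ := Submodule.Quotient.mk_surjective _ a
      obtain ⟨y, hy⟩ := (Submodule.Quotient.mk_eq_zero _).1 ha
      obtain ⟨z, hz⟩ := H x hx ⟨y, congrArg Subtype.val hy⟩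
      exact (Submodule.Quotient.mk_eq_zero _).2 ⟨z, Subtype.ext hz⟩
  · change Function.Surjective h ↔ _
    constructor
    · intro H y hy
      obtain ⟨a, ha⟩ := H (Submodule.Quotient.mk ⟨y, hy⟩)
      obtain ⟨⟨x, hx⟩, rfl⟩ := Submodule.Quotient.mk_surjective _ a
      obtain ⟨z, hz⟩ := (Submodule.Quotient.eq _).1 ha
      refine ⟨x, hx, -z, ?_⟩
      have : T.f z = φ.τ₂ x - y := congrArg Subtype.val hz
      rw [map_neg, this]
      abel
    · intro H b
      obtain ⟨⟨y, hy⟩, rfl⟩ := Submodule.Quotient.mk_surjective _ b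
      obtain ⟨x, hx, z, hz⟩ := H y hy
      refine ⟨Submodule.Quotient.mk ⟨x, hx⟩, (Submodule.Quotient.eq _).2 ⟨-z, Subtype.ext ?_⟩⟩
      change T.f (-z) = φ.τ₂ x - y
      rw [hz, map_neg]
      abel

/-- Every element of a coproduct of modules is the sum of the images of its components. -/
theorem cofan_eq_sum {ι : Type u} {Z : ι → ModuleCat.{u} R} {c : Cofan Z} (hc : IsColimit c)
    (x : c.pt) : ∃ (s : Finset ι) (z : ∀ i, Z i), x = ∑ i ∈ s, c.inj i (z i) := by
  classical
  let e := (coproductCoconeIsColimit Z).coconePointUniqueUpToIso hc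
  have he : ∀ i (a : Z i), e.hom (DirectSum.lof R ι (fun i => Z i) i a) = c.inj i a := fun i a => by
    have := (coproductCoconeIsColimit Z).comp_coconePointUniqueUpToIso_hom hc ⟨i⟩
    exact congrArg (fun f => f.hom a) this
  obtain ⟨y, rfl⟩ : ∃ y, e.hom y = x := ⟨e.inv x, by simp⟩
  let y' : DirectSum ι (fun i => Z i) := y
  let e' : DirectSum ι (fun i => Z i) →ₗ[R] c.pt := e.hom.hom
  refine ⟨y'.support, fun i => y' i, ?_⟩
  have : y' = ∑ i ∈ y'.support, DirectSum.lof R ι (fun i => Z i) i (y' i) :=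
    (DirectSum.sum_support_of y').symm
  exact ((congrArg e' this).trans (map_sum e' _ _)).trans (Finset.sum_congr rfl fun i _ => he i _)

end ModuleCat

namespace HomologicalComplex

variable {R : Type u} [Ring R] {κ : Type*} {cs : ComplexShape κ}

theorem quasiIso_iff_elements {K L : HomologicalComplex (ModuleCat.{u} R) cs} (f : K ⟶ L) :
    QuasiIso f ↔ ∀ n,
      (∀ x : K.X n, K.d n (cs.next n) x = 0 → (∃ y, L.d (cs.prev n) n y = f.f n x) →
        ∃ z, K.d (cs.prev n) n z = x) ∧
      (∀ y : L.X n, L.d n (cs.next n) y = 0 →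
        ∃ x, K.d n (cs.next n) x = 0 ∧ ∃ z, y = f.f n x + L.d (cs.prev n) n z) := by
  rw [quasiIso_iff]
  refine forall_congr' fun n => ?_
  rw [quasiIsoAt_iff]
  exact ModuleCat.shortComplex_quasiIso_iff _

/-- Direct sums of modules are exact: an element of a direct sum is a finite sum of its components,
so cycles and boundaries can be tested one component at a time through the projections `π i`. -/
theorem quasiIso_of_isColimit_cofan {ι : Type u}
    {K L : ι → HomologicalComplex (ModuleCat.{u} R) cs} {c : Cofan K} {c' : Cofan L}
    (hc : IsColimit c) (hc' : IsColimit c') (φ : ∀ i, K i ⟶ L i) [∀ i, QuasiIso (φ i)]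
    (f : c.pt ⟶ c'.pt) (hf : ∀ i, c.inj i ≫ f = φ i ≫ c'.inj i) : QuasiIso f := by
  classical
  have hcX : ∀ n, IsColimit (Cofan.mk (c.pt.X n) fun i => (c.inj i).f n) := fun n =>
    isColimitCofanMkObjOfIsColimit (eval _ cs n) _ _ (hc.ofIsoColimit (Cocone.ext (Iso.refl _)))
  have hcX' : ∀ n, IsColimit (Cofan.mk (c'.pt.X n) fun i => (c'.inj i).f n) := fun n =>
    isColimitCofanMkObjOfIsColimit (eval _ cs n) _ _ (hc'.ofIsoColimit (Cocone.ext (Iso.refl _)))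
  let π : ∀ i, c.pt ⟶ K i := fun i => Cofan.IsColimit.desc hc fun j =>
    if h : j = i then eqToHom (by rw [h]) else 0
  let π' : ∀ i, c'.pt ⟶ L i := fun i => Cofan.IsColimit.desc hc' fun j =>
    if h : j = i then eqToHom (by rw [h]) else 0
  have hπ : ∀ i j, c.inj j ≫ π i = if h : j = i then eqToHom (by rw [h]) else 0 := fun i j =>
    Cofan.IsColimit.fac hc _ _
  have hπ' : ∀ i j, c'.inj j ≫ π' i = if h : j = i then eqToHom (by rw [h]) else 0 := fun i j =>
    Cofan.IsColimit.fac hc' _ _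
  have hfπ : ∀ i, f ≫ π' i = π i ≫ φ i := fun i => by
    refine Cofan.IsColimit.hom_ext hc _ _ fun j => ?_
    rw [reassoc_of% (hf j), hπ', reassoc_of% (hπ i j)]
    by_cases h : j = i
    · subst h; simp
    · simp [h]
  -- Stated for an arbitrary cofan because it serves both for the source and for the target of `f`.
  have key : ∀ {K : ι → HomologicalComplex (ModuleCat.{u} R) cs} {c : Cofan K}
      (_ : ∀ n, IsColimit (Cofan.mk (c.pt.X n) fun i => (c.inj i).f n)) (π : ∀ i, c.pt ⟶ K i)
      (_ : ∀ i j, c.inj j ≫ π i = if h : j = i then eqToHom (by rw [h]) else 0)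
      (n : κ) (x : c.pt.X n), ∃ s : Finset ι, x = ∑ i ∈ s, (c.inj i).f n ((π i).f n x) := by
    intro K c hcX π hπ n x
    obtain ⟨s, z, rfl⟩ := ModuleCat.cofan_eq_sum (hcX n) x
    refine ⟨s, Finset.sum_congr rfl fun i hi => ?_⟩
    simp only [Cofan.mk_pt, cofan_mk_inj]
    congr 1
    rw [map_sum, Finset.sum_eq_single i]
    · rw [← ConcreteCategory.comp_apply, ← HomologicalComplex.comp_f, hπ]
      simp
    · intro j _ hj
      rw [← ConcreteCategory.comp_apply, ← HomologicalComplex.comp_f, hπ]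
      simp [hj]
    · exact fun h => (h hi).elim
  have comm : ∀ {A B : HomologicalComplex (ModuleCat.{u} R) cs} (g : A ⟶ B) (m n : κ)
      (x : A.X m), g.f n (A.d m n x) = B.d m n (g.f m x) := fun g m n x => by
    rw [← ConcreteCategory.comp_apply, ← ConcreteCategory.comp_apply, g.comm]
  have ffact : ∀ {A B C : HomologicalComplex (ModuleCat.{u} R) cs}
      {D : HomologicalComplex (ModuleCat.{u} R) cs}
      {a : A ⟶ B} {b : B ⟶ D} {a' : A ⟶ C} {b' : C ⟶ D} (_ : a ≫ b = a' ≫ b') (n : κ)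
      (x : A.X n), b.f n (a.f n x) = b'.f n (a'.f n x) := fun h n x => by
    rw [← ConcreteCategory.comp_apply, ← ConcreteCategory.comp_apply, ← HomologicalComplex.comp_f,
      h, HomologicalComplex.comp_f]
  have hqi := fun i => (quasiIso_iff_elements (φ i)).1 inferInstance
  refine (quasiIso_iff_elements f).2 fun n => ⟨?_, ?_⟩
  · rintro x hx ⟨y, hy⟩
    have : ∀ i, ∃ z, (K i).d (cs.prev n) n z = (π i).f n x := fun i =>
      (hqi i n).1 ((π i).f n x) (by rw [← comm, hx, map_zero])
        ⟨(π' i).f _ y, by rw [← comm, hy, ffact (hfπ i)]⟩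
    choose z hz using this
    obtain ⟨s, hs⟩ := key hcX π hπ n x
    refine ⟨∑ i ∈ s, (c.inj i).f _ (z i), ?_⟩
    rw [map_sum]
    refine (Finset.sum_congr rfl fun i _ => ?_).trans hs.symm
    rw [← comm, hz]
  · intro y hy
    have : ∀ i, ∃ x, (K i).d n (cs.next n) x = 0 ∧ ∃ z,
        (π' i).f n y = (φ i).f n x + (L i).d (cs.prev n) n z := fun i =>
      (hqi i n).2 ((π' i).f n y) (by rw [← comm, hy, map_zero])
    choose x hx z hz using this
    obtain ⟨s, hs⟩ := key hcX' π' hπ' n y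
    refine ⟨∑ i ∈ s, (c.inj i).f n (x i), ?_, ∑ i ∈ s, (c'.inj i).f _ (z i), ?_⟩
    · rw [map_sum]
      refine Finset.sum_eq_zero fun i _ => ?_
      rw [← comm, hx, map_zero]
    · rw [map_sum, map_sum, ← Finset.sum_add_distrib]
      refine hs.trans (Finset.sum_congr rfl fun i _ => ?_)
      rw [hz, map_add, ffact (hf i), comm]

end HomologicalComplex

/-! ### Coproducts in the derived category. -/

namespace DerivedCategory

section

variable {C : Type*} [Category* C] [Abelian C] [HasDerivedCategory.{w} C]

/-- A morphism of complexes vanishes in the derived category as soon as it factors, after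
precomposition with a quasi-isomorphism, through the contractible complex
`mappingCocone (𝟙 Y)`. -/
theorem exists_quasiIso_lift_of_Q_map_eq_zero {X Y : CochainComplex C ℤ} (g : X ⟶ Y)
    (hg : Q.map g = 0) : ∃ (X' : CochainComplex C ℤ) (t : X' ⟶ X) (_ : QuasiIso t)
      (b : X' ⟶ CochainComplex.mappingCocone (𝟙 Y)),
        b ≫ CochainComplex.mappingCocone.fst (𝟙 Y) = t ≫ g := by
  have h0 : Qh.map ((HomotopyCategory.quotient C (ComplexShape.up ℤ)).map g) =
      Qh.map 0 := by
    rw [← cancel_mono ((quotientCompQhIso C).hom.app Y), quotientCompQhIso_hom_naturality, hg]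
    simp
  -- Calculus of fractions: a morphism of the homotopy category dies in the localization only if
  -- some quasi-isomorphism into its source kills it.
  obtain ⟨X', s, hs, h⟩ := (MorphismProperty.map_eq_iff_precomp Qh
    (HomotopyCategory.quasiIso C (ComplexShape.up ℤ)) _ _).1 h0
  obtain ⟨X', rfl⟩ := HomotopyCategory.quotient_obj_surjective X'
  obtain ⟨t, rfl⟩ := (HomotopyCategory.quotient _ _).map_surjective s
  have ht : QuasiIso t := by
    rw [← isIso_Qh_map_iff] at hs
    rw [← isIso_Q_map_iff_quasiIso]
    exact hs
  rw [comp_zero, ← Functor.map_comp, ← Functor.map_zero] at h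
  have hh := HomotopyCategory.homotopyOfEq _ _ h
  obtain ⟨z, hz⟩ := CochainComplex.HomComplex.Cochain.equivHomotopy _ _ hh
  -- A null-homotopy of `t ≫ g` is, up to sign, a lift to the cocone of the identity.
  refine ⟨X', t, ht, CochainComplex.mappingCocone.lift _ (t ≫ g) (-z) ?_,
    CochainComplex.mappingCocone.lift_fst _ _ _ _⟩
  rw [Category.comp_id, hz]
  simp

theorem isZero_Q_mappingCocone_id (Y : CochainComplex C ℤ) :
    IsZero (Q.obj (CochainComplex.mappingCocone (𝟙 Y))) := by
  have := mappingCocone_triangle_distinguished (𝟙 Y)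
  refine (Pretriangulated.Triangle.isZero₁_iff_isIso₂ _ this).2 ?_
  change IsIso (Q.map (𝟙 Y))
  infer_instance

end

variable {R : Type u} [Ring R] [HasDerivedCategory.{w} (ModuleCat.{u} R)]

/-- The localization functor from complexes of modules to the derived category preserves
coproducts. -/
theorem nonempty_isColimit_Q_cofan {ι : Type u} {K : ι → CochainComplex (ModuleCat.{u} R) ℤ}
    {c : Cofan K} (hc : IsColimit c) :
    Nonempty (IsColimit (Cofan.mk (Q.obj c.pt) fun i => Q.map (c.inj i))) := by
  -- Uniqueness: the lifts `b i` assemble over the coproduct of the `K' i`, so `g` is killed by the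
  -- single quasi-isomorphism `T`.
  have hzero : ∀ {Y : CochainComplex (ModuleCat.{u} R) ℤ} (f : Q.obj c.pt ⟶ Q.obj Y),
      (∀ i, Q.map (c.inj i) ≫ f = 0) → f = 0 := by
    intro Y f hf
    obtain ⟨Y', g, s, hs, rfl⟩ := left_fac f
    have hg : ∀ i, Q.map (c.inj i ≫ g) = 0 := fun i => by
      have := hf i
      rw [← Category.assoc, ← Functor.map_comp] at this
      rw [← cancel_mono (inv (Q.map s)), this, zero_comp]
    choose K' t ht b hb using fun i => exists_quasiIso_lift_of_Q_map_eq_zero _ (hg i)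
    let T : ∐ K' ⟶ c.pt := Sigma.desc fun i => t i ≫ c.inj i
    have hT : QuasiIso T := HomologicalComplex.quasiIso_of_isColimit_cofan
      (c := Cofan.mk (∐ K') (Sigma.ι K')) (coproductIsCoproduct K') hc t T (fun i => by simp [T])
    have : T ≫ g = Sigma.desc b ≫ CochainComplex.mappingCocone.fst (𝟙 Y') := by
      ext1 i
      simp [T, hb]
    have h0 : Q.map T ≫ Q.map g = 0 := by
      rw [← Functor.map_comp, this, Functor.map_comp,
        (isZero_Q_mappingCocone_id Y').eq_of_src (Q.map _) 0, comp_zero]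
    have : Q.map g = 0 := by rw [← cancel_epi (Q.map T), h0, comp_zero]
    rw [this, zero_comp]
  -- Existence: represent each `f i` by a roof; the coproduct of the denominators is again a
  -- quasi-isomorphism, hence a common denominator.
  have hex : ∀ {Y : CochainComplex (ModuleCat.{u} R) ℤ} (f : ∀ i, Q.obj (K i) ⟶ Q.obj Y),
      ∃ g : Q.obj c.pt ⟶ Q.obj Y, ∀ i, Q.map (c.inj i) ≫ g = f i := by
    intro Y f
    choose K' s hs g hf using fun i => right_fac (f i)
    have hs' : ∀ i, QuasiIso (s i) := fun i => (isIso_Q_map_iff_quasiIso _ (s i)).1 (hs i)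
    let T : ∐ K' ⟶ c.pt := Sigma.desc fun i => s i ≫ c.inj i
    have hT : QuasiIso T := HomologicalComplex.quasiIso_of_isColimit_cofan
      (c := Cofan.mk (∐ K') (Sigma.ι K')) (coproductIsCoproduct K') hc s T (fun i => by simp [T])
    refine ⟨inv (Q.map T) ≫ Q.map (Sigma.desc g), fun i => ?_⟩
    have h1 : Q.map (s i) ≫ Q.map (c.inj i) = Q.map (Sigma.ι K' i) ≫ Q.map T := by
      rw [← Functor.map_comp, ← Functor.map_comp]
      simp [T]
    rw [hf i, ← cancel_epi (Q.map (s i)), reassoc_of% h1]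
    simp [← Functor.map_comp]
  have hex' : ∀ {Y : DerivedCategory (ModuleCat.{u} R)} (f : ∀ i, Q.obj (K i) ⟶ Y),
      ∃ g : Q.obj c.pt ⟶ Y, ∀ i, Q.map (c.inj i) ≫ g = f i := by
    intro Y f
    obtain ⟨g, hg⟩ := hex fun i => f i ≫ (Q.objObjPreimageIso Y).inv
    exact ⟨g ≫ (Q.objObjPreimageIso Y).hom, fun i => by simp [reassoc_of% (hg i)]⟩
  choose g hg using @hex'
  refine ⟨Cofan.IsColimit.mk _ (fun s => g fun i => s.inj i) (fun s i => hg _ i) fun s m hm => ?_⟩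
  rw [← cancel_mono (Q.objObjPreimageIso s.pt).inv, ← sub_eq_zero]
  refine hzero _ fun i => ?_
  rw [Preadditive.comp_sub, sub_eq_zero, ← Category.assoc, ← Category.assoc]
  congr 1
  exact (hm i).trans (hg _ i).symm

end DerivedCategory
end

/-! ### Localizing subcategories: reduction from complexes to modules. -/

noncomputable section

open CategoryTheory Limits DerivedCategory

theorem ModuleCat.shortExact_map_single {R : Type u} [Ring R] {L M N : Type u} [AddCommGroup L]
    [AddCommGroup M] [AddCommGroup N] [Module R L] [Module R M] [Module R N] (f : L →ₗ[R] M)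
    (g : M →ₗ[R] N) (hf : Function.Injective f) (hfg : Function.Exact f g)
    (hg : Function.Surjective g) :
    ((ModuleCat.shortComplexOfCompEqZero f g hfg.linearMap_comp_eq_zero).map
      (HomologicalComplex.single _ (ComplexShape.up ℤ) 0)).ShortExact :=
  (ModuleCat.shortComplex_shortExact _ hfg hf hg).map_of_exact _

namespace IsLocalizingSubcategory

variable {R : Type u} [Ring R] [HasDerivedCategory.{w} (ModuleCat.{u} R)]
  (P : ObjectProperty (DerivedCategory (ModuleCat.{u} R))) [IsLocalizingSubcategory.{u} P]

section Complexes

theorem prop_Q₁ {S : ShortComplex (CochainComplex (ModuleCat.{u} R) ℤ)} (hS : S.ShortExact)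
    (h₂ : P (Q.obj S.X₂)) (h₃ : P (Q.obj S.X₃)) : P (Q.obj S.X₁) :=
  P.ext_of_isTriangulatedClosed₁ _ (triangleOfSES_distinguished hS) h₂ h₃

theorem prop_Q₂ {S : ShortComplex (CochainComplex (ModuleCat.{u} R) ℤ)} (hS : S.ShortExact)
    (h₁ : P (Q.obj S.X₁)) (h₃ : P (Q.obj S.X₃)) : P (Q.obj S.X₂) :=
  P.ext_of_isTriangulatedClosed₂ _ (triangleOfSES_distinguished hS) h₁ h₃

theorem prop_Q₃ {S : ShortComplex (CochainComplex (ModuleCat.{u} R) ℤ)} (hS : S.ShortExact)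
    (h₁ : P (Q.obj S.X₁)) (h₂ : P (Q.obj S.X₂)) : P (Q.obj S.X₃) :=
  P.ext_of_isTriangulatedClosed₃ _ (triangleOfSES_distinguished hS) h₁ h₂

theorem prop_Q_of_quasiIso {K L : CochainComplex (ModuleCat.{u} R) ℤ} (f : K ⟶ L) [QuasiIso f]
    (h : P (Q.obj K)) : P (Q.obj L) :=
  P.prop_of_iso (asIso (Q.map f)) h

theorem prop_Q_of_isColimit_cofan {ι : Type u} {K : ι → CochainComplex (ModuleCat.{u} R) ℤ}
    {c : Cofan K} (hc : IsColimit c) (h : ∀ i, P (Q.obj (K i))) : P (Q.obj c.pt) := by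
  have := IsLocalizingSubcategory.coproducts (P := P) ι
  obtain ⟨hc'⟩ := nonempty_isColimit_Q_cofan hc
  exact P.prop_of_isColimit hc' fun ⟨i⟩ => h i

/-- The modules that belong to a localizing subcategory, when placed in degree `0`. -/
def modules : ObjectProperty (ModuleCat.{u} R) := P.inverseImage (singleFunctor _ 0)

theorem prop_singleFunctor (M : ModuleCat.{u} R) (h : modules P M) (n : ℤ) :
    P ((singleFunctor _ n).obj M) :=
  P.prop_of_iso (((singleFunctors (ModuleCat.{u} R)).shiftIso (-n) n 0 (by simp)).app M)
    (P.le_shift (-n) _ h)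

/-- Without differentials, a complex is the coproduct of its terms, each placed in its own degree.
-/
theorem prop_Q_of_d_eq_zero (K : CochainComplex (ModuleCat.{u} R) ℤ) (hd : ∀ i j, K.d i j = 0)
    (h : ∀ i, modules P (K.X i)) : P (Q.obj K) := by
  let ι : ∀ i : ULift.{u} ℤ, (HomologicalComplex.single _ (ComplexShape.up ℤ) i.down).obj
      (K.X i.down) ⟶ K := fun i =>
    HomologicalComplex.mkHomFromSingle (𝟙 _) fun j _ => by rw [hd, comp_zero]
  refine prop_Q_of_isColimit_cofan P (c := Cofan.mk K ι) ?_
    fun i => prop_singleFunctor P _ (h i.down) i.down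
  refine Cofan.IsColimit.mk _ (fun s =>
    { f := fun n => (HomologicalComplex.singleObjXSelf (ComplexShape.up ℤ) n (K.X n)).inv ≫
        (s.inj ⟨n⟩).f n
      comm' := fun i j _ => by
        rw [Category.assoc, (s.inj ⟨i⟩).comm]
        simp [hd] }) ?_ ?_
  · intro s i
    refine HomologicalComplex.from_single_hom_ext ?_
    simp [ι]
  · intro s m hm
    ext n : 1
    have := congrArg (fun f => f.f n) (hm ⟨n⟩)
    simp only [← this]
    simp [ι]

/-- The cycles form a subcomplex with zero differential, and the quotient by it is the complex of
boundaries, again with zero differential. -/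
theorem prop_of_forall_modules (h : ∀ M, modules P M) (X) : P X := by
  suffices ∀ K : CochainComplex (ModuleCat.{u} R) ℤ, P (Q.obj K) from
    P.prop_of_iso (Q.objObjPreimageIso X) (this _)
  intro K
  let Z : CochainComplex (ModuleCat.{u} R) ℤ :=
    { X := fun i => ModuleCat.of R (LinearMap.ker (K.d i (i + 1)).hom)
      d := fun _ _ => 0 }
  -- The term in degree `i` consists of the boundaries lying in degree `i + 1`, so that the
  -- differential of `K` becomes a map `g` of degree zero.
  let B : CochainComplex (ModuleCat.{u} R) ℤ :=
    { X := fun i => ModuleCat.of R (LinearMap.range (K.d i (i + 1)).hom)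
      d := fun _ _ => 0 }
  let f : Z ⟶ K :=
    { f := fun i => ModuleCat.ofHom (Submodule.subtype _)
      comm' := by
        rintro i _ rfl
        ext x
        exact x.2 }
  let g : K ⟶ B :=
    { f := fun i => ModuleCat.ofHom (LinearMap.rangeRestrict _)
      comm' := by
        rintro i _ rfl
        refine ModuleCat.hom_ext (LinearMap.ext fun x => Subtype.ext (Eq.symm ?_))
        change (K.d i (i + 1) ≫ K.d (i + 1) _) x = 0
        simp }
  have hfg : f ≫ g = 0 := by
    ext i : 1
    exact ModuleCat.hom_ext (LinearMap.ext fun x => Subtype.ext x.2)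
  refine prop_Q₂ P (S := ShortComplex.mk f g hfg) ?_
    (prop_Q_of_d_eq_zero P Z (fun _ _ => rfl) fun _ => h _)
    (prop_Q_of_d_eq_zero P B (fun _ _ => rfl) fun _ => h _)
  refine HomologicalComplex.shortExact_of_degreewise_shortExact _ fun i =>
    ModuleCat.shortComplex_shortExact _ ?_ ?_ ?_
  · change Function.Exact (Submodule.subtype _) (LinearMap.rangeRestrict (K.d i (i + 1)).hom)
    exact LinearMap.exact_iff.2 (by rw [LinearMap.ker_rangeRestrict, Submodule.range_subtype])
  · exact Subtype.val_injective
  · exact LinearMap.surjective_rangeRestrict (K.d i (i + 1)).hom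

end Complexes

section Modules

theorem modules_of_iso {M N : ModuleCat.{u} R} (e : M ≅ N) (h : modules P M) : modules P N :=
  P.prop_of_iso ((singleFunctor _ 0).mapIso e) h

theorem modules_of_linearEquiv {M N : Type u} [AddCommGroup M] [AddCommGroup N] [Module R M]
    [Module R N] (e : M ≃ₗ[R] N) (h : modules P (.of R M)) : modules P (.of R N) :=
  modules_of_iso P e.toModuleIso h

variable {L M N : Type u} [AddCommGroup L] [AddCommGroup M] [AddCommGroup N] [Module R L]
  [Module R M] [Module R N] {f : L →ₗ[R] M} {g : M →ₗ[R] N}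

theorem modules₁ (hf : Function.Injective f) (hfg : Function.Exact f g)
    (hg : Function.Surjective g) (h₂ : modules P (.of R M)) (h₃ : modules P (.of R N)) :
    modules P (.of R L) :=
  prop_Q₁ P (ModuleCat.shortExact_map_single f g hf hfg hg) h₂ h₃

theorem modules₂ (hf : Function.Injective f) (hfg : Function.Exact f g)
    (hg : Function.Surjective g) (h₁ : modules P (.of R L)) (h₃ : modules P (.of R N)) :
    modules P (.of R M) :=
  prop_Q₂ P (ModuleCat.shortExact_map_single f g hf hfg hg) h₁ h₃

theorem modules₃ (hf : Function.Injective f) (hfg : Function.Exact f g)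
    (hg : Function.Surjective g) (h₁ : modules P (.of R L)) (h₂ : modules P (.of R M)) :
    modules P (.of R N) :=
  prop_Q₃ P (ModuleCat.shortExact_map_single f g hf hfg hg) h₁ h₂

theorem modules_of_subsingleton [Subsingleton M] : modules P (.of R M) :=
  P.prop_of_isZero ((singleFunctor _ 0).map_isZero (ModuleCat.isZero_of_subsingleton (.of R M)))

theorem modules_finsupp (ι : Type u) (h : modules P (.of R M)) : modules P (.of R (ι →₀ M)) := by
  classical
  let c : Cofan fun _ : ι => ModuleCat.of R M :=
    Cofan.mk (ModuleCat.of R (ι →₀ M)) fun i => ModuleCat.ofHom (Finsupp.lsingle i)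
  have hc : IsColimit c := Cofan.IsColimit.mk _
    (fun s => ModuleCat.ofHom (Finsupp.lsum ℕ fun i => (s.inj i).hom))
    (fun s i => by
      ext x
      simp [c, Cofan.inj])
    (fun s m hm => by
      refine ModuleCat.hom_ext (Finsupp.lhom_ext fun i x => ?_)
      have := congrArg (fun f => f.hom x) (hm i)
      simpa [c, Cofan.inj] using this)
  exact prop_Q_of_isColimit_cofan P (isColimitCofanMkObjOfIsColimit
    (HomologicalComplex.single _ (ComplexShape.up ℤ) 0) _ _ hc) fun _ => h

end Modules

end IsLocalizingSubcategory
end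

/-! ### Exact differentials on a single module and the telescope of truncations. -/

noncomputable section

open CategoryTheory Limits DerivedCategory

/-- The complex whose term in degree `i` is the submodule `p i` of a fixed module `F`, and whose
differentials are the restrictions of endomorphisms `d i` of `F`. -/
def CochainComplex.ofSubmodules {R : Type u} [Ring R] {F : Type u} [AddCommGroup F] [Module R F]
    (d : ℤ → F →ₗ[R] F) (p : ℤ → Submodule R F) (hd : ∀ i, ∀ x ∈ p i, d (i + 1) (d i x) = 0)
    (hp : ∀ i, ∀ x ∈ p i, d i x ∈ p (i + 1)) : CochainComplex (ModuleCat.{u} R) ℤ where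
  X i := ModuleCat.of R (p i)
  d i j := if h : i + 1 = j then ModuleCat.ofHom ((d i).restrict (p := p i) (q := p j)
    fun x hx => h ▸ hp i x hx) else 0
  shape i j h := dif_neg h
  d_comp_d' := by
    rintro i _ _ rfl rfl
    rw [dif_pos rfl, dif_pos rfl]
    exact ModuleCat.hom_ext (LinearMap.ext fun x => Subtype.ext (hd i x x.2))

/-- Neighbouring degrees enter as variables, which avoids transport along `prev` and `next`. -/
theorem CochainComplex.quasiIso_of_elements {R : Type u} [Ring R]
    {K L : CochainComplex (ModuleCat.{u} R) ℤ} (f : K ⟶ L)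
    (h : ∀ i j l, i + 1 = j → j + 1 = l →
      (∀ x : K.X j, K.d j l x = 0 → (∃ y, L.d i j y = f.f j x) → ∃ z, K.d i j z = x) ∧
      (∀ y : L.X j, L.d j l y = 0 → ∃ x, K.d j l x = 0 ∧ ∃ z, y = f.f j x + L.d i j z)) :
    QuasiIso f :=
  (HomologicalComplex.quasiIso_iff_elements f).2 fun n => h _ _ _ (by simp) (by simp)

namespace CochainComplex.ofSubmodules

variable {R : Type u} [Ring R] {F G H : Type u} [AddCommGroup F] [Module R F] [AddCommGroup G]
  [Module R G] [AddCommGroup H] [Module R H]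
  {d : ℤ → F →ₗ[R] F} {p : ℤ → Submodule R F} {hd : ∀ i, ∀ x ∈ p i, d (i + 1) (d i x) = 0}
  {hp : ∀ i, ∀ x ∈ p i, d i x ∈ p (i + 1)}
  {e : ℤ → G →ₗ[R] G} {q : ℤ → Submodule R G} {he : ∀ i, ∀ x ∈ q i, e (i + 1) (e i x) = 0}
  {hq : ∀ i, ∀ x ∈ q i, e i x ∈ q (i + 1)}
  {δ : ℤ → H →ₗ[R] H} {r : ℤ → Submodule R H} {hδ : ∀ i, ∀ x ∈ r i, δ (i + 1) (δ i x) = 0}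
  {hr : ∀ i, ∀ x ∈ r i, δ i x ∈ r (i + 1)}

theorem d_eq (i : ℤ) : (ofSubmodules d p hd hp).d i (i + 1) =
    ModuleCat.ofHom ((d i).restrict (hp i)) :=
  dif_pos rfl

/-- Morphisms from a complex `ofSubmodules`. -/
def desc {K : CochainComplex (ModuleCat.{u} R) ℤ} (f : ∀ i, p i →ₗ[R] K.X i)
    (hf : ∀ i (x : p i), (K.d i (i + 1)).hom (f i x) = f (i + 1) ⟨d i x, hp i x x.2⟩) :
    ofSubmodules d p hd hp ⟶ K where
  f i := ModuleCat.ofHom (f i)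
  comm' := by
    rintro i _ rfl
    rw [d_eq]
    exact ModuleCat.hom_ext (LinearMap.ext (hf i))

/-- Morphisms between complexes `ofSubmodules`. -/
def hom (f : ℤ → F →ₗ[R] G) (hf : ∀ i, ∀ x ∈ p i, f i x ∈ q i)
    (hfd : ∀ i, ∀ x ∈ p i, e i (f i x) = f (i + 1) (d i x)) :
    ofSubmodules d p hd hp ⟶ ofSubmodules e q he hq :=
  desc (fun i => (f i).restrict (hf i)) fun i x => by
    rw [d_eq]
    exact Subtype.ext (hfd i x x.2)

/-- Exactness is demanded only on the submodules; on the ambient modules the maps need not even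
compose to zero. -/
theorem shortExact (f : ℤ → F →ₗ[R] G) (hf : ∀ i, ∀ x ∈ p i, f i x ∈ q i)
    (hfd : ∀ i, ∀ x ∈ p i, e i (f i x) = f (i + 1) (d i x))
    (g : ℤ → G →ₗ[R] H) (hg : ∀ i, ∀ x ∈ q i, g i x ∈ r i)
    (hgd : ∀ i, ∀ x ∈ q i, δ i (g i x) = g (i + 1) (e i x))
    (hinj : ∀ i, ∀ x ∈ p i, f i x = 0 → x = 0)
    (hzero : ∀ i, ∀ x ∈ p i, g i (f i x) = 0)
    (hex : ∀ i, ∀ y ∈ q i, g i y = 0 → ∃ x ∈ p i, f i x = y)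
    (hsurj : ∀ i, ∀ z ∈ r i, ∃ y ∈ q i, g i y = z) :
    (ShortComplex.mk (hom f hf hfd : ofSubmodules d p hd hp ⟶ ofSubmodules e q he hq)
      (hom g hg hgd : _ ⟶ ofSubmodules δ r hδ hr) (by
        ext i : 1
        exact ModuleCat.hom_ext (LinearMap.ext fun (x : p i) =>
          Subtype.ext (hzero i x x.2)))).ShortExact := by
  refine HomologicalComplex.shortExact_of_degreewise_shortExact _ fun i =>
    ModuleCat.shortComplex_shortExact _ ?_ ?_ ?_
  · change Function.Exact ((f i).restrict (hf i)) ((g i).restrict (hg i))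
    intro y
    constructor
    · intro hy
      obtain ⟨x, hx, h⟩ := hex i y y.2 (congrArg Subtype.val hy)
      exact ⟨⟨x, hx⟩, Subtype.ext h⟩
    · rintro ⟨x, rfl⟩
      exact Subtype.ext (hzero i x x.2)
  · change Function.Injective ((f i).restrict (hf i))
    rw [injective_iff_map_eq_zero]
    exact fun x hx => Subtype.ext (hinj i x x.2 (congrArg Subtype.val hx))
  · change Function.Surjective ((g i).restrict (hg i))
    intro z
    obtain ⟨y, hy, h⟩ := hsurj i z z.2
    exact ⟨⟨y, hy⟩, Subtype.ext h⟩

end CochainComplex.ofSubmodules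

namespace IsLocalizingSubcategory

open CochainComplex

section

variable {R : Type u} [Ring R] {F : Type u} [AddCommGroup F] [Module R F] (d : F →ₗ[R] F)
  (hd : ∀ x, d (d x) = 0)

/-- The submodule that is everything or zero according to a condition. -/
def _root_.Submodule.ofProp (R : Type u) [Ring R] (F : Type u) [AddCommGroup F] [Module R F]
    (a : Prop) : Submodule R F where
  carrier := {x | ¬ a → x = 0}
  zero_mem' := fun _ => rfl
  add_mem' hx hy h := by rw [hx h, hy h, add_zero]
  smul_mem' c x hx h := by rw [hx h, smul_zero]

/-- The differentials of a complex concentrated in nonpositive degrees. -/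
def nonposDiff (d : F →ₗ[R] F) (i : ℤ) : F →ₗ[R] F := if i < 0 then d else 0

theorem nonposDiff_of_neg {i : ℤ} (h : i < 0) : nonposDiff d i = d := if_pos h

theorem nonposDiff_of_nonneg {i : ℤ} (h : 0 ≤ i) : nonposDiff d i = 0 := if_neg h.not_gt

theorem nonposDiff_nonposDiff (hd : ∀ x, d (d x) = 0) (i j : ℤ) (x : F) :
    nonposDiff d j (nonposDiff d i x) = 0 := by
  unfold nonposDiff
  split_ifs <;> simp [hd]

theorem nonposDiff_mem (n : ℕ) (i : ℤ) (x : F) (hx : x ∈ Submodule.ofProp R F (-n ≤ i ∧ i ≤ 0)) :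
    nonposDiff d i x ∈ Submodule.ofProp R F (-n ≤ i + 1 ∧ i + 1 ≤ 0) := fun h => by
  by_cases hi : i < 0
  · rw [hx (by omega), map_zero]
  · rw [nonposDiff_of_nonneg _ (by omega), LinearMap.zero_apply]

theorem nonposDiff_mem' (i : ℤ) (x : F) :
    nonposDiff d i x ∈ Submodule.ofProp R F (i + 1 ≤ 0) := fun h => by
  rw [nonposDiff_of_nonneg _ (by omega), LinearMap.zero_apply]

/-- The finite complex `F → F → ⋯ → F`, with differential `d`, in degrees `-n, …, 0`. -/
abbrev truncated (n : ℕ) : CochainComplex (ModuleCat.{u} R) ℤ :=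
  ofSubmodules (nonposDiff d) (fun i => Submodule.ofProp R F (-n ≤ i ∧ i ≤ 0))
    (fun _ _ _ => nonposDiff_nonposDiff d hd _ _ _) (nonposDiff_mem d n)

/-- The infinite complex `⋯ → F → F → F`, with differential `d`, in nonpositive degrees. -/
abbrev resolution : CochainComplex (ModuleCat.{u} R) ℤ :=
  ofSubmodules (nonposDiff d) (fun i => Submodule.ofProp R F (i ≤ 0))
    (fun _ _ _ => nonposDiff_nonposDiff d hd _ _ _) (fun i x _ => nonposDiff_mem' d i x)

end

variable {R : Type u} [Ring R] [HasDerivedCategory.{w} (ModuleCat.{u} R)]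
  (P : ObjectProperty (DerivedCategory (ModuleCat.{u} R))) [IsLocalizingSubcategory.{u} P]
  {F : Type u} [AddCommGroup F] [Module R F] (d : F →ₗ[R] F) (hd : ∀ x, d (d x) = 0)

theorem modules_ofProp (hF : modules P (.of R F)) (a : Prop) :
    modules P (.of R (Submodule.ofProp R F a)) := by
  by_cases h : a
  · refine modules_of_linearEquiv P (LinearEquiv.symm (LinearEquiv.ofTop _ ?_)) hF
    exact Submodule.eq_top_iff'.2 fun x h' => (h' h).elim
  · have : Subsingleton (Submodule.ofProp R F a) :=
      ⟨fun x y => Subtype.ext ((x.2 h).trans (y.2 h).symm)⟩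
    exact modules_of_subsingleton P

theorem prop_Q_concentrated (hF : modules P (.of R F)) (a : ℤ → Prop) :
    P (Q.obj (ofSubmodules (0 : ℤ → F →ₗ[R] F) (fun i => Submodule.ofProp R F (a i))
      (fun _ _ _ => rfl) (fun _ _ _ _ => rfl))) := by
  refine prop_Q_of_d_eq_zero P _ (fun i j => ?_) fun i => modules_ofProp P hF _
  by_cases h : i + 1 = j
  · subst h
    exact ofSubmodules.d_eq i
  · exact dif_neg h

theorem prop_Q_truncated (hF : modules P (.of R F)) (n : ℕ) : P (Q.obj (truncated d hd n)) := by
  classical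
  induction n with
  | zero =>
    refine prop_Q_of_d_eq_zero P _ (fun i j => ?_) fun i => modules_ofProp P hF _
    by_cases h : i + 1 = j
    · subst h
      refine (ofSubmodules.d_eq i).trans ?_
      refine ModuleCat.hom_ext (LinearMap.ext fun x => Subtype.ext ?_)
      change nonposDiff d i x = 0
      by_cases hi : i < 0
      · rw [x.2 (by omega), map_zero]
      · rw [nonposDiff_of_nonneg _ (by omega), LinearMap.zero_apply]
    · exact dif_neg h
  | succ n ih =>
    -- The longer truncation is an extension of one copy of `F`, placed in degree `-(n + 1)`, by the
    -- shorter one.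
    refine prop_Q₂ P (ofSubmodules.shortExact
      (hd := fun _ _ _ => nonposDiff_nonposDiff d hd _ _ _) (hp := nonposDiff_mem d n)
      (he := fun _ _ _ => nonposDiff_nonposDiff d hd _ _ _) (hq := nonposDiff_mem d (n + 1))
      (d := nonposDiff d) (p := fun i => Submodule.ofProp R F (-n ≤ i ∧ i ≤ 0))
      (e := nonposDiff d) (q := fun i => Submodule.ofProp R F (-(n + 1 : ℕ) ≤ i ∧ i ≤ 0))
      (δ := 0) (r := fun i => Submodule.ofProp R F (i = -(n + 1 : ℕ)))
      (hδ := fun _ _ _ => rfl) (hr := fun _ _ _ _ => rfl)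
      (fun _ => LinearMap.id) ?_ ?_
      (fun i => if i = -(n + 1 : ℕ) then LinearMap.id else 0) ?_ ?_ ?_ ?_ ?_ ?_) ih
      (prop_Q_concentrated P hF _)
    · exact fun i x hx h => hx (by omega)
    · exact fun i x hx => rfl
    · intro i x hx h
      rw [if_neg h, LinearMap.zero_apply]
    · intro i x hx
      rw [Pi.zero_apply, LinearMap.zero_apply]
      split_ifs with h
      · rw [hx (by omega)]; simp
      · rfl
    · exact fun i x hx h => h
    · intro i x hx
      split_ifs with h
      · exact hx (by omega)
      · rfl
    · intro i y hy h
      refine ⟨y, fun h' => ?_, rfl⟩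
      split_ifs at h with h''
      · exact h
      · exact hy (by omega)
    · intro i z hz
      by_cases h : i = -(n + 1 : ℕ)
      · exact ⟨z, fun h' => hz (by omega), by rw [if_pos h]; rfl⟩
      · exact ⟨0, fun _ => rfl, by rw [hz h, map_zero]⟩

/-- The submodule of the finitely supported functions all of whose values `f n` belong to `p n`. -/
def _root_.Submodule.finsupp {R : Type u} [Ring R] {F : Type u} [AddCommGroup F] [Module R F]
    {κ : Type*} (p : κ → Submodule R F) : Submodule R (κ →₀ F) where
  carrier := {f | ∀ n, f n ∈ p n}
  zero_mem' := fun _ => zero_mem _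
  add_mem' hx hy n := add_mem (hx n) (hy n)
  smul_mem' c _ hx n := Submodule.smul_mem _ c (hx n)

/-- The direct sum of the complexes `truncated d hd n`. -/
abbrev truncatedSum : CochainComplex (ModuleCat.{u} R) ℤ :=
  ofSubmodules (F := ℕ →₀ F) (fun i => Finsupp.mapRange.linearMap (nonposDiff d i))
    (fun i => Submodule.finsupp fun n : ℕ => Submodule.ofProp R F (-n ≤ i ∧ i ≤ 0))
    (fun i x _ => Finsupp.ext fun n => nonposDiff_nonposDiff d hd i (i + 1) (x n))
    (fun i x hx n => nonposDiff_mem d n i (x n) (hx n))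

theorem prop_Q_truncatedSum (hF : modules P (.of R F)) : P (Q.obj (truncatedSum d hd)) := by
  classical
  let c : Cofan fun n : ULift.{u} ℕ => truncated d hd n.down :=
    Cofan.mk (truncatedSum d hd) fun n => ofSubmodules.hom (fun _ => Finsupp.lsingle n.down)
      (fun i x hx m => by
        change Finsupp.single n.down x m ∈ _
        by_cases h : n.down = m
        · subst h
          rw [Finsupp.single_eq_same]
          exact hx
        · rw [Finsupp.single_eq_of_ne' h]
          exact zero_mem _)
      (fun i x hx => by
        change Finsupp.mapRange (nonposDiff d i) (map_zero _) (Finsupp.single _ _) =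
          Finsupp.single _ _
        rw [Finsupp.mapRange_single])
  refine prop_Q_of_isColimit_cofan P (c := c) ?_ fun n => prop_Q_truncated P d hd hF _
  -- The components of the cofan, extended by zero to all of `F` in the degrees where the truncation
  -- vanishes; `Finsupp.lsum` can then add them up.
  let g : ∀ (s : Cofan fun n : ULift.{u} ℕ => truncated d hd n.down) (i : ℤ) (n : ℕ),
      F →ₗ[R] s.pt.X i := fun s i n =>
    if h : -n ≤ i ∧ i ≤ 0 then ((s.inj ⟨n⟩).f i).hom ∘ₗ
      LinearMap.codRestrict (Submodule.ofProp R F (-n ≤ i ∧ i ≤ 0)) LinearMap.id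
        (fun _ h' => (h' h).elim) else 0
  have hg : ∀ s (i : ℤ) (n : ℕ) (x : Submodule.ofProp R F (-n ≤ i ∧ i ≤ 0)),
      g s i n x = ((s.inj ⟨n⟩).f i).hom x := by
    intro s i n x
    by_cases h : -n ≤ i ∧ i ≤ 0
    · simp only [g]
      rw [dif_pos h]
      rfl
    · have : x = 0 := Subtype.ext (x.2 h)
      subst this
      exact (map_zero (g s i n)).trans (map_zero ((s.inj ⟨n⟩).f i).hom).symm
  have hgd : ∀ s (i : ℤ) (n : ℕ) (x : Submodule.ofProp R F (-n ≤ i ∧ i ≤ 0)),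
      (s.pt.d i (i + 1)).hom (g s i n x) = g s (i + 1) n (nonposDiff d i x) := by
    intro s i n x
    have := congrArg (fun f => f.hom x) ((s.inj ⟨n⟩).comm i (i + 1))
    rw [hg]
    refine this.trans ?_
    rw [ofSubmodules.d_eq]
    exact (hg s (i + 1) n _).symm
  refine Cofan.IsColimit.mk _ (fun s => ofSubmodules.desc
    (p := fun i => Submodule.finsupp fun n : ℕ => Submodule.ofProp R F (-n ≤ i ∧ i ≤ 0))
    (hd := fun i x _ => Finsupp.ext fun n => nonposDiff_nonposDiff d hd i (i + 1) (x n))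
    (hp := fun i x hx n => nonposDiff_mem d n i (x n) (hx n))
    (fun i => Finsupp.lsum ℕ (g s i) ∘ₗ Submodule.subtype _) ?_) ?_ ?_
  · intro i f
    change (s.pt.d i (i + 1)).hom (f.1.sum fun n => g s i n) =
      Finsupp.sum (Finsupp.mapRange (nonposDiff d i) (map_zero _) f.1) fun n => g s (i + 1) n
    rw [Finsupp.sum_mapRange_index (fun _ => map_zero _), Finsupp.sum, map_sum]
    exact Finset.sum_congr rfl fun n _ => hgd s i n ⟨f.1 n, f.2 n⟩
  · intro s n
    ext i : 1
    refine ModuleCat.hom_ext (LinearMap.ext fun x => ?_)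
    refine Eq.trans ?_ (hg s i n.down x)
    exact Finsupp.sum_single_index (map_zero (g s i n.down))
  · intro s m hm
    ext i : 1
    refine ModuleCat.hom_ext (LinearMap.ext fun
      (f : Submodule.finsupp fun n : ℕ => Submodule.ofProp R F (-n ≤ i ∧ i ≤ 0)) => ?_)
    change _ = f.1.sum fun n => g s i n
    have h : ∀ n : ℕ, Finsupp.single n (f.1 n) ∈ Submodule.finsupp fun n : ℕ =>
        Submodule.ofProp R F (-n ≤ i ∧ i ≤ 0) := fun n k => by
      by_cases h : n = k
      · subst h
        rw [Finsupp.single_eq_same]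
        exact f.2 n
      · rw [Finsupp.single_eq_of_ne' h]
        exact zero_mem _
    have hf : f = ∑ n ∈ f.1.support, ⟨Finsupp.single n (f.1 n), h n⟩ := by
      refine Subtype.ext ((Finsupp.sum_single f.1).symm.trans ?_)
      rw [AddSubmonoidClass.coe_finsetSum]
      rfl
    refine ((congrArg (m.f i).hom hf).trans (map_sum (m.f i).hom _ _)).trans ?_
    refine Finset.sum_congr rfl fun n _ => ?_
    refine Eq.trans ?_ (hg s i n ⟨f.1 n, f.2 n⟩).symm
    exact congrArg (fun φ => (φ.f i).hom ⟨f.1 n, f.2 n⟩) (hm ⟨n⟩)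

/-- The resolution is the union of its truncations `Tₙ`, so the telescope `0 → ⨁ Tₙ → ⨁ Tₙ →
resolution → 0` is exact, the first map being the identity minus the shift `Tₙ ⊆ Tₙ₊₁` and the
second the sum. -/
theorem prop_Q_resolution (hF : modules P (.of R F)) : P (Q.obj (resolution d hd)) := by
  classical
  have hA := prop_Q_truncatedSum P d hd hF
  have succ_apply : ∀ (x : ℕ →₀ F) (n : ℕ), Finsupp.mapDomain Nat.succ x (n + 1) = x n :=
    fun x n => Finsupp.mapDomain_apply Nat.succ_injective x n
  have zero_apply : ∀ x : ℕ →₀ F, Finsupp.mapDomain Nat.succ x 0 = 0 :=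
    fun x => Finsupp.mapDomain_of_notMem_range _ _ (by simp)
  refine prop_Q₃ P (ofSubmodules.shortExact
    (hd := fun i x _ => Finsupp.ext fun n => nonposDiff_nonposDiff d hd i (i + 1) (x n))
    (hp := fun i x hx n => nonposDiff_mem d n i (x n) (hx n))
    (he := fun i x _ => Finsupp.ext fun n => nonposDiff_nonposDiff d hd i (i + 1) (x n))
    (hq := fun i x hx n => nonposDiff_mem d n i (x n) (hx n))
    (hδ := fun _ _ _ => nonposDiff_nonposDiff d hd _ _ _) (hr := fun i x _ => nonposDiff_mem' d i x)
    (d := fun i => Finsupp.mapRange.linearMap (nonposDiff d i))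
    (p := fun i => Submodule.finsupp fun n : ℕ => Submodule.ofProp R F (-n ≤ i ∧ i ≤ 0))
    (e := fun i => Finsupp.mapRange.linearMap (nonposDiff d i))
    (q := fun i => Submodule.finsupp fun n : ℕ => Submodule.ofProp R F (-n ≤ i ∧ i ≤ 0))
    (δ := nonposDiff d) (r := fun i => Submodule.ofProp R F (i ≤ 0))
    (fun _ => LinearMap.id - Finsupp.lmapDomain F R Nat.succ) ?_ ?_
    (fun _ => Finsupp.lsum ℕ fun _ => LinearMap.id) ?_ ?_ ?_ ?_ ?_ ?_) hA hA
  · intro i x hx n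
    refine sub_mem (hx n) ?_
    cases n with
    | zero => exact (zero_apply x).symm ▸ zero_mem _
    | succ n => exact (succ_apply x n).symm ▸ fun h => hx n (by omega)
  · intro i x hx
    change Finsupp.mapRange.linearMap (nonposDiff d i) (x - Finsupp.mapDomain Nat.succ x) =
      Finsupp.mapRange.linearMap (nonposDiff d i) x - _
    rw [map_sub]
    congr 1
    exact (Finsupp.mapDomain_mapRange _ _ _ (map_zero _) (fun _ _ => map_add _ _ _)).symm
  · intro i x hx h
    change x.sum (fun _ y => y) = 0
    exact Finset.sum_eq_zero fun n _ => hx n fun h' => h h'.2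
  · intro i x hx
    change nonposDiff d i (x.sum fun _ y => y) =
      (Finsupp.mapRange (nonposDiff d i) (map_zero _) x).sum fun _ y => y
    rw [Finsupp.sum_mapRange_index (fun _ => rfl), Finsupp.sum, map_sum]
    rfl
  · intro i x hx h
    have h' : ∀ n, x n = Finsupp.mapDomain Nat.succ x n := fun n =>
      DFunLike.congr_fun (sub_eq_zero.1 h) n
    ext n
    induction n with
    | zero => rw [h', zero_apply]; rfl
    | succ n ih => rw [h', succ_apply, ih]; rfl
  · intro i x hx
    change (Finsupp.lsum ℕ fun _ => LinearMap.id) (x - Finsupp.mapDomain Nat.succ x) = 0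
    rw [map_sub, sub_eq_zero]
    exact (Finsupp.sum_mapDomain_index (h := fun _ y => y) (fun _ => rfl)
      (fun _ _ _ => rfl)).symm
  · intro i y hy h
    have hsum : y.sum (fun _ z => z) = 0 := h
    -- Identity minus shift is inverted by partial sums. From the largest index of the support on,
    -- they equal the total sum, which is zero, so the preimage has finite support.
    refine ⟨Finsupp.onFinset (Finset.range (y.support.sup id))
      (fun n => ∑ m ∈ Finset.range (n + 1), y m) fun n hn => ?_, fun n hn => ?_, ?_⟩
    · by_contra hn'
      refine hn (Eq.trans (Eq.symm ?_) hsum)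
      refine Finset.sum_subset (fun m hm => ?_) fun m _ hm => Finsupp.notMem_support_iff.1 hm
      have : m ≤ y.support.sup id := Finset.le_sup (f := id) hm
      rw [Finset.mem_range] at hn' ⊢
      omega
    · refine Finset.sum_eq_zero (s := Finset.range (n + 1)) fun m hm => hy m ?_
      rw [Finset.mem_range] at hm
      omega
    · ext n
      rw [LinearMap.sub_apply, Finsupp.sub_apply]
      change (∑ m ∈ Finset.range (n + 1), y m) - Finsupp.mapDomain Nat.succ _ n = y n
      cases n with
      | zero => rw [zero_apply]; simp
      | succ n =>
        rw [succ_apply, Finset.sum_range_succ, Finsupp.onFinset_apply]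
        abel
  · intro i z hz
    -- The first truncation that reaches down to degree `i` is the one with index `-i`.
    refine ⟨Finsupp.single (-i).toNat z, fun n hn => ?_, ?_⟩
    · by_cases h : (-i).toNat = n
      · rw [← h, Finsupp.single_eq_same]
        exact hz (by omega)
      · exact Finsupp.single_eq_of_ne' h
    · exact Finsupp.sum_single_index rfl

/-- A module is in a localizing subcategory if it is the image of an exact differential on a
module in this subcategory. -/
theorem modules_range_of_ker_eq_range (hF : modules P (.of R F))
    (hker : LinearMap.ker d = LinearMap.range d) : modules P (.of R (LinearMap.range d)) := by
  have hd : ∀ x, d (d x) = 0 := fun x => (SetLike.ext_iff.1 hker (d x)).2 ⟨x, rfl⟩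
  let φ : (resolution d hd).X 0 ⟶ ModuleCat.of R (LinearMap.range d) :=
    ModuleCat.ofHom (d.rangeRestrict ∘ₗ Submodule.subtype _)
  have hφ : ∀ i, (ComplexShape.up ℤ).Rel i 0 → (resolution d hd).d i 0 ≫ φ = 0 := fun i hi => by
    obtain rfl : i = -1 := by
      have : i + 1 = 0 := hi
      omega
    refine (congrArg (· ≫ φ) (ofSubmodules.d_eq (-1))).trans ?_
    exact ModuleCat.hom_ext (LinearMap.ext fun x => Subtype.ext (hd (Subtype.val x)))
  let f : resolution d hd ⟶ (HomologicalComplex.single _ (ComplexShape.up ℤ) 0).obj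
      (ModuleCat.of R (LinearMap.range d)) := HomologicalComplex.mkHomToSingle φ hφ
  have hd0 : ∀ i j, ((HomologicalComplex.single _ (ComplexShape.up ℤ) 0).obj
      (ModuleCat.of R (LinearMap.range d))).d i j = 0 :=
    fun i j => HomologicalComplex.single_obj_d _ _ _ _ _
  have hf : QuasiIso f := quasiIso_of_elements f fun i j l hij hjl => by
    subst hij hjl
    -- Elements killed by `d` are boundaries even in degree `0`. There the differential of the
    -- resolution vanishes, but the augmentation `φ` is `d` itself, so the same fact gives
    -- injectivity on homology.
    have hlift : i + 1 ≤ 0 → ∀ x : Submodule.ofProp R F (i + 1 ≤ 0), d x.1 = 0 →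
        ∃ z : (resolution d hd).X i, ((resolution d hd).d i (i + 1)).hom z = x := by
      intro hi x hx
      obtain ⟨z, hz⟩ := (SetLike.ext_iff.1 hker x.1).1 hx
      refine ⟨⟨z, fun h => (h (by omega)).elim⟩, ?_⟩
      rw [ofSubmodules.d_eq]
      refine Subtype.ext (Eq.trans ?_ hz)
      change nonposDiff d i z = d z
      rw [nonposDiff_of_neg _ (by omega)]
    rcases eq_or_ne (i + 1) 0 with h0 | h0
    · obtain rfl : i = -1 := by omega
      have hf0 : ∀ x, (f.f 0).hom x = (HomologicalComplex.singleObjXSelf (ComplexShape.up ℤ) 0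
          (ModuleCat.of R (LinearMap.range d))).inv.hom (φ.hom x) := fun x => by
        rw [show f.f 0 = _ from HomologicalComplex.mkHomToSingle_f φ hφ]
        rfl
      refine ⟨fun x hx hy => hlift le_rfl x ?_, fun y hy => ?_⟩
      · obtain ⟨y, hy⟩ := hy
        have h : (φ x : LinearMap.range d) = 0 := by
          refine (ModuleCat.mono_iff_injective (HomologicalComplex.singleObjXSelf
            (ComplexShape.up ℤ) 0 (ModuleCat.of R (LinearMap.range d))).inv).1 inferInstance
            (((hf0 x).symm.trans ?_).trans (map_zero _).symm)
          rw [hd0] at hy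
          exact hy.symm
        exact congrArg Subtype.val h
      · obtain ⟨y, rfl⟩ : ∃ y', (HomologicalComplex.singleObjXSelf (ComplexShape.up ℤ) 0
            (ModuleCat.of R (LinearMap.range d))).inv y' = y := ⟨_, Iso.hom_inv_id_apply _ y⟩
        obtain ⟨x, hx⟩ := y.2
        refine ⟨⟨x, fun h => (h le_rfl).elim⟩, ?_, 0, ?_⟩
        · rw [ofSubmodules.d_eq]
          exact Subtype.ext rfl
        · rw [map_zero, add_zero]
          refine Eq.trans ?_ (hf0 _).symm
          exact congrArg _ (Subtype.ext hx.symm)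
    · have : Subsingleton (((HomologicalComplex.single _ (ComplexShape.up ℤ) 0).obj
          (ModuleCat.of R (LinearMap.range d))).X (i + 1)) :=
        ModuleCat.subsingleton_of_isZero (HomologicalComplex.isZero_single_obj_X _ _ _ _ h0)
      refine ⟨fun x hx _ => ?_, fun y _ => ⟨0, map_zero _, 0, Subsingleton.elim _ _⟩⟩
      by_cases h : i + 1 ≤ 0
      · refine hlift h x ?_
        rw [ofSubmodules.d_eq] at hx
        have hx' : nonposDiff d (i + 1) (Subtype.val x) = 0 := congrArg Subtype.val hx
        rwa [nonposDiff_of_neg _ (by omega)] at hx'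
      · exact ⟨0, (map_zero _).trans (Subtype.ext (x.2 h)).symm⟩
  exact @prop_Q_of_quasiIso _ _ _ P _ _ _ f hf (prop_Q_resolution P d hd hF)

end IsLocalizingSubcategory
end

/-! ### A basis of `Λ(q)` and the cube of its augmentation ideal. -/

noncomputable section

namespace RZAlgebra

variable {k : Type u} [Field k] (q : k)

theorem induction {p : RZAlgebra k q → Prop} (algebraMap : ∀ c, p (algebraMap k _ c))
    (gen : ∀ i, p (gen k q i)) (add : ∀ a b, p a → p b → p (a + b))
    (mul : ∀ a b, p a → p b → p (a * b)) (a : RZAlgebra k q) : p a := by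
  obtain ⟨b, rfl⟩ := RingQuot.mkAlgHom_surjective k (RZRel k q) a
  induction b using FreeAlgebra.induction with
  | grade0 c => exact (AlgHom.commutes (RingQuot.mkAlgHom k (RZRel k q)) c).symm ▸ algebraMap c
  | grade1 i => exact gen i
  | mul a b ha hb => exact (map_mul (RingQuot.mkAlgHom k (RZRel k q)) a b).symm ▸ mul _ _ ha hb
  | add a b ha hb => exact (map_add (RingQuot.mkAlgHom k (RZRel k q)) a b).symm ▸ add _ _ ha hb

theorem mkAlgHom_eq_zero {a : FreeAlgebra k RZGen} (h : RZRel k q a 0) :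
    RingQuot.mkAlgHom k (RZRel k q) a = 0 :=
  (RingQuot.mkAlgHom_rel k h).trans (map_zero _)

theorem xx : gen k q .x * gen k q .x = 0 :=
  (map_mul (RingQuot.mkAlgHom k (RZRel k q)) _ _).symm.trans (mkAlgHom_eq_zero q .xx)

theorem yy : gen k q .y * gen k q .y = 0 :=
  (map_mul (RingQuot.mkAlgHom k (RZRel k q)) _ _).symm.trans (mkAlgHom_eq_zero q .yy)

theorem zz : gen k q .z * gen k q .z = 0 :=
  (map_mul (RingQuot.mkAlgHom k (RZRel k q)) _ _).symm.trans (mkAlgHom_eq_zero q .zz)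

theorem zy : gen k q .z * gen k q .y = 0 :=
  (map_mul (RingQuot.mkAlgHom k (RZRel k q)) _ _).symm.trans (mkAlgHom_eq_zero q .zy)

theorem yx : gen k q .y * gen k q .x = -(q • (gen k q .x * gen k q .y)) := by
  have h := mkAlgHom_eq_zero q (.yx (k := k) (q := q))
  rw [map_add, map_smul, map_mul, map_mul] at h
  exact eq_neg_of_add_eq_zero_left h

theorem zx : gen k q .z * gen k q .x = gen k q .x * gen k q .z := by
  have h := mkAlgHom_eq_zero q (.zx (k := k) (q := q))
  rw [map_sub, map_mul, map_mul] at h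
  exact sub_eq_zero.1 h

theorem yz : gen k q .y * gen k q .z = gen k q .x * gen k q .z := by
  have h := mkAlgHom_eq_zero q (.yz (k := k) (q := q))
  rw [map_sub, map_mul, map_mul] at h
  exact sub_eq_zero.1 h

/-- The linear combinations of `1, x, y, z, xy, xz`. -/
def ofCoords : (Fin 6 → k) →ₗ[k] RZAlgebra k q where
  toFun c := c 0 • (1 : RZAlgebra k q) + c 1 • gen k q .x + c 2 • gen k q .y + c 3 • gen k q .z +
    c 4 • (gen k q .x * gen k q .y) + c 5 • (gen k q .x * gen k q .z)
  map_add' c d := by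
    simp only [Pi.add_apply, add_smul]
    abel
  map_smul' r c := by
    simp only [Pi.smul_apply, smul_eq_mul, mul_smul, smul_add, RingHom.id_apply]

theorem ofCoords_apply (c : Fin 6 → k) : ofCoords q c =
    c 0 • (1 : RZAlgebra k q) + c 1 • gen k q .x + c 2 • gen k q .y + c 3 • gen k q .z +
    c 4 • (gen k q .x * gen k q .y) + c 5 • (gen k q .x * gen k q .z) := rfl

/-- Left multiplication by a generator in terms of the basis `1, x, y, z, xy, xz`. -/
def genEnd : RZGen → Module.End k (Fin 6 → k)
  | .x => Matrix.toLin' !![0, 0, 0, 0, 0, 0; 1, 0, 0, 0, 0, 0; 0, 0, 0, 0, 0, 0; 0, 0, 0, 0, 0, 0;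
      0, 0, 1, 0, 0, 0; 0, 0, 0, 1, 0, 0]
  | .y => Matrix.toLin' !![0, 0, 0, 0, 0, 0; 0, 0, 0, 0, 0, 0; 1, 0, 0, 0, 0, 0; 0, 0, 0, 0, 0, 0;
      0, -q, 0, 0, 0, 0; 0, 0, 0, 1, 0, 0]
  | .z => Matrix.toLin' !![0, 0, 0, 0, 0, 0; 0, 0, 0, 0, 0, 0; 0, 0, 0, 0, 0, 0; 1, 0, 0, 0, 0, 0;
      0, 0, 0, 0, 0, 0; 0, 1, 0, 0, 0, 0]

theorem genEnd_x (c : Fin 6 → k) : genEnd q .x c = ![0, c 0, 0, 0, c 2, c 3] := by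
  ext i
  fin_cases i <;> simp [genEnd, Matrix.mulVec, dotProduct, Fin.sum_univ_six]

theorem genEnd_y (c : Fin 6 → k) : genEnd q .y c = ![0, 0, c 0, 0, -q * c 1, c 3] := by
  ext i
  fin_cases i <;> simp [genEnd, Matrix.mulVec, dotProduct, Fin.sum_univ_six]

theorem genEnd_z (c : Fin 6 → k) : genEnd q .z c = ![0, 0, 0, c 0, 0, c 1] := by
  ext i
  fin_cases i <;> simp [genEnd, Matrix.mulVec, dotProduct, Fin.sum_univ_six]

/-- The left regular representation of `Λ(q)` with respect to the basis
`1, x, y, z, xy, xz`. -/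
def regularRep : RZAlgebra k q →ₐ[k] Module.End k (Fin 6 → k) :=
  RingQuot.liftAlgHom k ⟨FreeAlgebra.lift k (genEnd q), by
    intro a b h
    cases h <;>
    · refine LinearMap.ext fun c => funext fun i => ?_
      fin_cases i <;> simp [genEnd_x, genEnd_y, genEnd_z]⟩

theorem regularRep_gen (i : RZGen) : regularRep q (gen k q i) = genEnd q i :=
  (RingQuot.liftAlgHom_mkAlgHom_apply k _ _ _).trans (FreeAlgebra.lift_ι_apply _ _)

/-- The relations move `x` to the front and kill or rewrite every other product, so the span of the
six monomials is stable under left multiplication. -/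
theorem gen_mul_ofCoords (i : RZGen) (c : Fin 6 → k) :
    gen k q i * ofCoords q c = ofCoords q (genEnd q i c) := by
  have xxa : ∀ a, gen k q .x * (gen k q .x * a) = 0 := fun a => by
    rw [← mul_assoc, xx, zero_mul]
  have yxa : ∀ a, gen k q .y * (gen k q .x * a) = -(q • (gen k q .x * (gen k q .y * a))) :=
    fun a => by rw [← mul_assoc, yx, neg_mul, smul_mul_assoc, mul_assoc]
  have zxa : ∀ a, gen k q .z * (gen k q .x * a) = gen k q .x * (gen k q .z * a) := fun a => by
    rw [← mul_assoc, zx, mul_assoc]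
  cases i
  · simp [ofCoords_apply, genEnd_x, mul_add, xx, xxa]
  · simp [ofCoords_apply, genEnd_y, mul_add, yx, yy, yz, yxa, xxa]
    module
  · simp [ofCoords_apply, genEnd_z, mul_add, zx, zy, zz, zxa]

theorem mul_ofCoords (a : RZAlgebra k q) (c : Fin 6 → k) :
    a * ofCoords q c = ofCoords q (regularRep q a c) := by
  induction a using RZAlgebra.induction generalizing c with
  | algebraMap r =>
    rw [AlgHom.commutes, ← Algebra.smul_def, Module.algebraMap_end_apply, map_smul]
  | gen i => rw [gen_mul_ofCoords, regularRep_gen]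
  | add a b ha hb => rw [add_mul, ha, hb, map_add, LinearMap.add_apply, map_add]
  | mul a b ha hb => rw [mul_assoc, hb, ha, map_mul, Module.End.mul_apply]

/-- The coordinates with respect to the basis `1, x, y, z, xy, xz`. -/
def coords : RZAlgebra k q →ₗ[k] Fin 6 → k :=
  LinearMap.applyₗ ![1, 0, 0, 0, 0, 0] ∘ₗ (regularRep q).toLinearMap

/-- The six monomials span: their span is a left ideal containing `1`. -/
theorem ofCoords_coords (a : RZAlgebra k q) : ofCoords q (coords q a) = a := by
  refine (mul_ofCoords q a _).symm.trans ?_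
  simp [ofCoords_apply]

/-- The six monomials are independent: in the regular representation they send the first unit vector
to the six unit vectors. -/
theorem coords_ofCoords (c : Fin 6 → k) : coords q (ofCoords q c) = c := by
  change regularRep q (ofCoords q c) _ = c
  ext i
  fin_cases i <;>
    simp [ofCoords_apply, regularRep_gen, genEnd_x, genEnd_y, genEnd_z]

theorem coords_gen_mul (i : RZGen) (a : RZAlgebra k q) :
    coords q (gen k q i * a) = genEnd q i (coords q a) := by
  change regularRep q (gen k q i * a) _ = genEnd q i (regularRep q a _)
  rw [map_mul, regularRep_gen, Module.End.mul_apply]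

/-- The augmentation of `Λ(q)`, which sends the generators to zero. -/
def aug : RZAlgebra k q →ₐ[k] k :=
  RingQuot.liftAlgHom k ⟨FreeAlgebra.lift k fun _ => 0, by
    intro a b h
    cases h <;> simp⟩

theorem aug_gen (i : RZGen) : aug q (gen k q i) = 0 :=
  (RingQuot.liftAlgHom_mkAlgHom_apply k _ _ _).trans (FreeAlgebra.lift_ι_apply _ _)

theorem aug_ofCoords (c : Fin 6 → k) : aug q (ofCoords q c) = c 0 := by
  simp [ofCoords_apply, aug_gen]

theorem coords_zero (a : RZAlgebra k q) : coords q a 0 = aug q a := by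
  rw [← aug_ofCoords q (coords q a), ofCoords_coords]

/-- Each factor raises the degree by at least one, and the basis `1, x, y, z, xy, xz` stops in
degree two. -/
theorem mul_mul_eq_zero {a b c : RZAlgebra k q} (ha : aug q a = 0) (hb : aug q b = 0)
    (hc : aug q c = 0) : a * (b * c) = 0 := by
  have key : ∀ (a : RZAlgebra k q) (v : Fin 6 → k), aug q a = 0 → ∃ r : Fin 6 → k,
      a * ofCoords q v = r 1 • ofCoords q (genEnd q .x v) + r 2 • ofCoords q (genEnd q .y v) +
        r 3 • ofCoords q (genEnd q .z v) + r 4 • ofCoords q (genEnd q .x (genEnd q .y v)) +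
        r 5 • ofCoords q (genEnd q .x (genEnd q .z v)) := fun a v h => by
    refine ⟨coords q a, ?_⟩
    rw [← coords_zero] at h
    conv_lhs => rw [← ofCoords_coords q a, ofCoords_apply, h]
    simp only [← gen_mul_ofCoords, zero_smul, zero_add, add_mul, smul_mul_assoc, mul_assoc]
  obtain ⟨r, hr⟩ := key b (coords q c) hb
  rw [← coords_zero] at hc
  rw [ofCoords_coords] at hr
  rw [hr]
  simp only [mul_add, mul_smul_comm]
  -- The span of `xy` and `xz` is annihilated by the augmentation ideal.
  have key' : ∀ v : Fin 6 → k, v 0 = 0 → v 1 = 0 → v 2 = 0 → v 3 = 0 → a * ofCoords q v = 0 := by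
    intro v h0 h1 h2 h3
    obtain ⟨r, hr⟩ := key a v ha
    rw [hr]
    simp [genEnd_x, genEnd_y, genEnd_z, ofCoords_apply, h0, h1, h2, h3]
  rw [key', key', key', key', key'] <;> simp [genEnd_x, genEnd_y, genEnd_z, hc]

end RZAlgebra

theorem RZModule.rep_ofCoords {k : Type u} [Field k] (q α : k) (c : Fin 6 → k) :
    rep q α (RZAlgebra.ofCoords q c) =
      !![c 0, c 1 * α + c 2, c 3; 0, c 0, 0; 0, 0, c 0] := by
  ext i j
  fin_cases i <;> fin_cases j <;>
    simp [RZAlgebra.ofCoords_apply, rep_gen, genMatrix]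

theorem RZModule.rep_mulVec {k : Type u} [Field k] (q α : k) (a : RZAlgebra k q) (w : Fin 3 → k) :
    (rep q α a).mulVec w = ![RZAlgebra.aug q a * w 0 + (RZAlgebra.coords q a 1 * α +
      RZAlgebra.coords q a 2) * w 1 + RZAlgebra.coords q a 3 * w 2, RZAlgebra.aug q a * w 1,
      RZAlgebra.aug q a * w 2] := by
  conv_lhs => rw [← RZAlgebra.ofCoords_coords q a, rep_ofCoords, RZAlgebra.coords_zero]
  ext i
  fin_cases i <;> simp [Matrix.mulVec, dotProduct, Fin.sum_univ_three]

end

/-! ### Localizing classes of modules, and dévissage from one-dimensional modules. -/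

noncomputable section

/-- The closure properties that the modules in a localizing subcategory containing the
injective modules have. -/
structure IsLocalizingModuleClass (R : Type u) [Ring R]
    (C : ∀ (M : Type u) [AddCommGroup M] [Module R M], Prop) : Prop where
  injective (M : Type u) [AddCommGroup M] [Module R M] : Module.Injective R M → C M
  equiv {M N : Type u} [AddCommGroup M] [Module R M] [AddCommGroup N] [Module R N] :
    (M ≃ₗ[R] N) → C M → C N
  left {L M N : Type u} [AddCommGroup L] [Module R L] [AddCommGroup M] [Module R M]
    [AddCommGroup N] [Module R N] (f : L →ₗ[R] M) (g : M →ₗ[R] N) (hf : Function.Injective f)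
    (hfg : Function.Exact f g) (hg : Function.Surjective g) : C M → C N → C L
  middle {L M N : Type u} [AddCommGroup L] [Module R L] [AddCommGroup M] [Module R M]
    [AddCommGroup N] [Module R N] (f : L →ₗ[R] M) (g : M →ₗ[R] N) (hf : Function.Injective f)
    (hfg : Function.Exact f g) (hg : Function.Surjective g) : C L → C N → C M
  right {L M N : Type u} [AddCommGroup L] [Module R L] [AddCommGroup M] [Module R M]
    [AddCommGroup N] [Module R N] (f : L →ₗ[R] M) (g : M →ₗ[R] N) (hf : Function.Injective f)
    (hfg : Function.Exact f g) (hg : Function.Surjective g) : C L → C M → C N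
  finsupp (ι : Type u) {M : Type u} [AddCommGroup M] [Module R M] : C M → C (ι →₀ M)
  range {M : Type u} [AddCommGroup M] [Module R M] (d : M →ₗ[R] M)
    (hd : LinearMap.ker d = LinearMap.range d) : C M → C (LinearMap.range d)

/-- The one-dimensional module given by a ring homomorphism to a field. -/
def OneDimensional {R k : Type u} [Ring R] [Field k] (_ε : R →+* k) : Type u := k

namespace OneDimensional

variable {R k : Type u} [Ring R] [Field k] (ε : R →+* k)

instance : AddCommGroup (OneDimensional ε) := inferInstanceAs (AddCommGroup k)

instance : Module R (OneDimensional ε) := Module.compHom k ε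

end OneDimensional

namespace IsLocalizingModuleClass

variable {R : Type u} [Ring R] {C : ∀ (M : Type u) [AddCommGroup M] [Module R M], Prop}

theorem of_range (hC : IsLocalizingModuleClass R C) {M N : Type u} [AddCommGroup M] [Module R M]
    [AddCommGroup N] [Module R N]
    (d : M →ₗ[R] M) (hd : LinearMap.ker d = LinearMap.range d) (f : N →ₗ[R] M)
    (hf : Function.Injective f) (hfd : LinearMap.range f = LinearMap.range d) (h : C M) : C N :=
  hC.equiv ((LinearEquiv.ofInjective f hf).trans (LinearEquiv.ofEq _ _ hfd)).symm
    (hC.range d hd h)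

/-- If countable direct sums of copies of a module belong to the class, then so does the
module. -/
theorem of_finsupp (hC : IsLocalizingModuleClass R C) {M : Type u} [AddCommGroup M] [Module R M]
    (h : C (ULift.{u} ℕ →₀ M)) :
    C M := by
  let s : ULift.{u} ℕ → ULift.{u} ℕ := fun n => ⟨n.down + 1⟩
  have hs : Function.Injective s := fun m n h =>
    ULift.ext _ _ (Nat.succ_injective (congrArg ULift.down h))
  -- The shift of `M^(ℕ)` is injective, and its cokernel is the coordinate at zero.
  refine hC.right (Finsupp.lmapDomain M R s) (Finsupp.lapply ⟨0⟩)
    (Finsupp.mapDomain_injective hs) (fun x => ⟨fun hx => ?_, ?_⟩)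
    (fun m => ⟨Finsupp.single ⟨0⟩ m, Finsupp.single_eq_same⟩) h h
  · refine ⟨Finsupp.comapDomain s x hs.injOn, Finsupp.mapDomain_comapDomain s hs x fun n hn => ?_⟩
    cases hn' : n.down with
    | zero =>
      have : n = ⟨0⟩ := ULift.ext _ _ hn'
      exact (Finsupp.mem_support_iff.1 hn (this ▸ hx)).elim
    | succ m => exact ⟨⟨m⟩, ULift.ext _ _ hn'.symm⟩
  · rintro ⟨y, rfl⟩
    exact Finsupp.mapDomain_of_notMem_range _ _ (by rintro ⟨n, hn⟩; cases hn)

/-- The action factors through `k`, and a basis of the resulting vector space displays `M` as a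
direct sum of copies of the one-dimensional module. -/
theorem of_forall_ker_smul (hC : IsLocalizingModuleClass R C) {k : Type u} [Field k]
    {ε : R →+* k} (hε : Function.Surjective ε)
    (h : C (OneDimensional ε)) (M : Type u) [AddCommGroup M] [Module R M]
    (hM : ∀ r, ε r = 0 → ∀ m : M, r • m = 0) : C M := by
  let φ : k →+* AddMonoid.End M := ε.liftOfSurjective hε
    ⟨Module.toAddMonoidEnd R M, fun r hr => AddMonoidHom.ext (hM r hr)⟩
  let _ : Module k M := Module.compHom M φ
  have hφ : ∀ (r : R) (m : M), ε r • m = r • m := fun r m =>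
    DFunLike.congr_fun (RingHom.liftOfRightInverse_comp_apply ε _
      (Function.rightInverse_surjInv hε)
      ⟨Module.toAddMonoidEnd R M, fun r hr => AddMonoidHom.ext (hM r hr)⟩ r) m
  let b := Module.Basis.ofVectorSpace k M
  let e : M ≃ₗ[R] (Module.Basis.ofVectorSpaceIndex k M →₀ OneDimensional ε) :=
    { b.repr.toAddEquiv with
      map_smul' := fun r m => (congrArg b.repr (hφ r m)).symm.trans (b.repr.map_smul (ε r) m) }
  exact hC.equiv e.symm (hC.finsupp _ h)

/-- If the modules annihilated by `K` belong to the class, then so do those annihilated by the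
products of elements of the kernel of `ε` and elements of `K`. -/
theorem of_forall_ker_mul_smul (hC : IsLocalizingModuleClass R C) {k : Type u} [Field k]
    {ε : R →+* k} (hε : Function.Surjective ε)
    (h : C (OneDimensional ε)) {K : R → Prop}
    (hK : ∀ (M : Type u) [AddCommGroup M] [Module R M], (∀ r, K r → ∀ m : M, r • m = 0) → C M)
    (M : Type u) [AddCommGroup M] [Module R M]
    (hM : ∀ r s, ε r = 0 → K s → ∀ m : M, r • s • m = 0) : C M := by
  -- The largest submodule annihilated by the kernel of `ε`; by hypothesis it contains `s • m`
  -- whenever `K s`, so `K` annihilates the quotient.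
  let N : Submodule R M :=
    { carrier := {m | ∀ r, ε r = 0 → r • m = 0}
      zero_mem' := fun r _ => smul_zero r
      add_mem' := fun hx hy r hr => by rw [smul_add, hx r hr, hy r hr, add_zero]
      smul_mem' := fun s x hx r hr => by
        rw [← mul_smul]
        exact hx _ (by rw [map_mul, hr, zero_mul]) }
  refine hC.middle N.subtype N.mkQ N.injective_subtype
    (LinearMap.exact_iff.2 (by rw [Submodule.ker_mkQ, Submodule.range_subtype])) N.mkQ_surjective
    (hC.of_forall_ker_smul hε h N fun r hr m => Subtype.ext (m.2 r hr)) (hK _ fun s hs m => ?_)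
  obtain ⟨m, rfl⟩ := N.mkQ_surjective m
  exact (Submodule.Quotient.mk_eq_zero N).2 fun r hr => hM r s hr hs m

end IsLocalizingModuleClass

/-- A linear map, viewed as a linear map for the module structures pulled back along a ring
homomorphism. -/
def LinearMap.compHom {R S M N : Type*} [Ring R] [Ring S] (e : S →+* R) [AddCommGroup M]
    [Module R M] [AddCommGroup N] [Module R N] (f : M →ₗ[R] N) :
    @LinearMap S S _ _ (RingHom.id S) M N _ _ (Module.compHom M e) (Module.compHom N e) :=
  @LinearMap.mk _ _ _ _ _ _ _ _ _ (_) (_) f.toAddHom fun s x => f.map_smul (e s) x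

theorem Module.Injective.compHom {R S M : Type u} [Ring R] [Ring S] (e : S ≃+* R) [AddCommGroup M]
    [Module R M] (hM : Module.Injective R M) :
    @Module.Injective S _ M _ (Module.compHom M e.toRingHom) := by
  let _ := Module.compHom M e.toRingHom
  refine ⟨fun X Y _ _ _ _ f hf g => ?_⟩
  let _ := Module.compHom X e.symm.toRingHom
  let _ := Module.compHom Y e.symm.toRingHom
  let g' : X →ₗ[R] M :=
    { g.toAddHom with
      map_smul' := fun r x => (g.map_smul (e.symm r) x).trans
        (congrArg (· • g x) (e.apply_symm_apply r)) }
  obtain ⟨h, hh⟩ := hM.out (LinearMap.compHom e.symm.toRingHom f) hf g'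
  refine ⟨{ h.toAddHom with map_smul' := fun s y => ?_ }, hh⟩
  exact (congrArg (fun t => h (t • y)) (e.symm_apply_apply s).symm).trans (h.map_smul (e s) y)

namespace IsLocalizingSubcategory

/-- The modules in a localizing subcategory that contains the injective modules, viewed as
modules over an isomorphic ring. -/
theorem isLocalizingModuleClass {R S : Type u} [Ring R] [Ring S] (e : S ≃+* R)
    [HasDerivedCategory.{w} (ModuleCat.{u} S)]
    (P : ObjectProperty (DerivedCategory (ModuleCat.{u} S))) [IsLocalizingSubcategory.{u} P]
    (hP : ∀ M, CategoryTheory.Injective M → modules P M) :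
    IsLocalizingModuleClass R fun M _ _ =>
      modules P (@ModuleCat.of S _ M _ (Module.compHom M e.toRingHom)) where
  injective M _ _ hM := by
    let _ := Module.compHom M e.toRingHom
    exact hP _ (Module.injective_object_of_injective_module S M (inj := hM.compHom e))
  equiv {M N} _ _ _ _ f h := by
    let _ := Module.compHom M e.toRingHom
    let _ := Module.compHom N e.toRingHom
    exact modules_of_linearEquiv P
      (LinearEquiv.ofBijective (LinearMap.compHom e.toRingHom f.toLinearMap) f.bijective) h
  left {L M N} _ _ _ _ _ _ f g hf hfg hg := by
    let _ := Module.compHom L e.toRingHom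
    let _ := Module.compHom M e.toRingHom
    let _ := Module.compHom N e.toRingHom
    exact modules₁ P (f := LinearMap.compHom e.toRingHom f) (g := LinearMap.compHom e.toRingHom g)
      hf hfg hg
  middle {L M N} _ _ _ _ _ _ f g hf hfg hg := by
    let _ := Module.compHom L e.toRingHom
    let _ := Module.compHom M e.toRingHom
    let _ := Module.compHom N e.toRingHom
    exact modules₂ P (f := LinearMap.compHom e.toRingHom f) (g := LinearMap.compHom e.toRingHom g)
      hf hfg hg
  right {L M N} _ _ _ _ _ _ f g hf hfg hg := by
    let _ := Module.compHom L e.toRingHom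
    let _ := Module.compHom M e.toRingHom
    let _ := Module.compHom N e.toRingHom
    exact modules₃ P (f := LinearMap.compHom e.toRingHom f) (g := LinearMap.compHom e.toRingHom g)
      hf hfg hg
  finsupp ι M _ _ h := by
    let _ := Module.compHom M e.toRingHom
    exact modules_finsupp P ι h
  range {M} _ _ d hd h := by
    let _ := Module.compHom M e.toRingHom
    let _ := Module.compHom (LinearMap.range d) e.toRingHom
    have := modules_range_of_ker_eq_range P (LinearMap.compHom e.toRingHom d) h
      (SetLike.ext fun x => SetLike.ext_iff.1 hd x)
    exact modules_of_linearEquiv P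
      { toFun := fun x => ⟨x.1, x.2⟩
        invFun := fun x => ⟨x.1, x.2⟩
        left_inv := fun _ => rfl
        right_inv := fun _ => rfl
        map_add' := fun _ _ => rfl
        map_smul' := fun _ _ => rfl } this

/-- A localizing subcategory that contains the injective modules is everything if every localizing
class of modules over an isomorphic ring is. -/
theorem prop_of_forall_isLocalizingModuleClass {R S : Type u} [Ring R] [Ring S] (e : S ≃+* R)
    [HasDerivedCategory.{w} (ModuleCat.{u} S)]
    (P : ObjectProperty (DerivedCategory (ModuleCat.{u} S))) [IsLocalizingSubcategory.{u} P]
    (hP : ∀ M, CategoryTheory.Injective M → modules P M)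
    (h : ∀ C : ∀ (M : Type u) [AddCommGroup M] [Module R M], Prop, IsLocalizingModuleClass R C →
      ∀ (M : Type u) [AddCommGroup M] [Module R M], C M) (X) : P X := by
  refine prop_of_forall_modules P (fun M => ?_) X
  let i : Module R M := Module.compHom M e.symm.toRingHom
  have hM := h _ (isLocalizingModuleClass e P hP) M
  let f : @LinearMap S S _ _ (RingHom.id S) M M _ _ (Module.compHom M e.toRingHom) _ :=
    @LinearMap.mk _ _ _ _ _ _ _ _ _ (_) _ (AddHom.id M) fun s x =>
      congrArg (· • x) (e.symm_apply_apply s)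
  exact modules_of_iso P (@LinearEquiv.toModuleIso S _ _ _ _ _ (_) _
    (LinearEquiv.ofBijective f Function.bijective_id)) hM

end IsLocalizingSubcategory
end

noncomputable section

/-! ### Injective modules over an algebra -/

/-- The dual of an algebra, as a left module. -/
def DualModule (k B : Type u) [Field k] [Ring B] [Algebra k B] : Type u := B →ₗ[k] k

namespace DualModule

variable {k B : Type u} [Field k] [Ring B] [Algebra k B]

instance : AddCommGroup (DualModule k B) := inferInstanceAs (AddCommGroup (B →ₗ[k] k))

instance : FunLike (DualModule k B) B k := inferInstanceAs (FunLike (B →ₗ[k] k) B k)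

instance : LinearMapClass (DualModule k B) k B k :=
  inferInstanceAs (LinearMapClass (B →ₗ[k] k) k B k)

@[ext] theorem ext {f g : DualModule k B} (h : ∀ a, f a = g a) : f = g := DFunLike.ext _ _ h

instance : Module B (DualModule k B) where
  smul b f := f ∘ₗ LinearMap.mulRight k b
  one_smul f := ext fun a => congrArg f (mul_one a)
  mul_smul b c f := ext fun a => congrArg f (mul_assoc a b c).symm
  smul_zero _ := rfl
  smul_add _ _ _ := rfl
  add_smul b c f := ext fun a => (congrArg f (mul_add a b c)).trans (map_add f _ _)
  zero_smul f := ext fun a => (congrArg f (mul_zero a)).trans (map_zero f)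

theorem smul_apply (b : B) (f : DualModule k B) (a : B) : (b • f) a = f (a * b) := rfl

/-- Since `g x a = g (a • x) 1`, a map `g` from a left ideal to the dual is determined by the
functional `y ↦ g y 1`, which extends from the ideal to `B` because `k` is a field. -/
theorem injective : Module.Injective B (DualModule k B) := by
  refine Module.Baer.injective fun I g => ?_
  let ψ : I.restrictScalars k →ₗ[k] k :=
    { toFun := fun y => g y 1
      map_add' := fun y z => DFunLike.congr_fun (g.map_add y z) 1
      map_smul' := fun c y => by
        rw [← algebraMap_smul B c y]
        refine (DFunLike.congr_fun (g.map_smul (algebraMap k B c) y) 1).trans ?_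
        rw [smul_apply, one_mul, Algebra.algebraMap_eq_smul_one]
        exact map_smul (g y) c 1 }
  obtain ⟨ψ', hψ'⟩ := LinearMap.exists_extend ψ
  refine ⟨{ toFun := fun b => ψ' ∘ₗ LinearMap.mulRight k b
            map_add' := fun b c => ext fun a => (congrArg ψ' (mul_add a b c)).trans (map_add ψ' _ _)
            map_smul' := fun b c => ext fun a => congrArg ψ' (mul_assoc a b c).symm }, ?_⟩
  intro x hx
  refine ext fun a => ?_
  refine (LinearMap.congr_fun hψ' ⟨a * x, I.mul_mem_left a hx⟩).trans ?_
  change g (a • ⟨x, hx⟩) 1 = _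
  rw [map_smul, smul_apply, one_mul]

end DualModule

theorem Module.Injective.of_retract {R M N : Type u} [Ring R] [AddCommGroup M] [Module R M]
    [AddCommGroup N] [Module R N] (h : Module.Injective R M) (i : N →ₗ[R] M) (r : M →ₗ[R] N)
    (hri : ∀ x, r (i x) = x) : Module.Injective R N := by
  refine ⟨fun X Y _ _ _ _ f hf g => ?_⟩
  obtain ⟨e, he⟩ := h.out f hf (i ∘ₗ g)
  exact ⟨r ∘ₗ e, fun x => (congrArg r (he x)).trans (hri _)⟩

/-! ### Modules over the one-point extension -/

/-- The one-point extension `Λ(q)[M(q)]`. -/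
abbrev RZExtension (k : Type u) [Field k] (q : k) : Type u :=
  OnePointExtension k (RZAlgebra k q) (RZModule k q q)

namespace RZExtension

variable (k : Type u) [Field k] (q : k)

/-- The projection to the upper left entry. -/
def fst : RZExtension k q →+* k where
  toFun s := s.c
  map_one' := rfl
  map_mul' _ _ := rfl
  map_zero' := rfl
  map_add' _ _ := rfl

/-- The projection to the lower right entry. -/
def snd : RZExtension k q →+* RZAlgebra k q where
  toFun s := s.a
  map_one' := rfl
  map_mul' _ _ := rfl
  map_zero' := rfl
  map_add' _ _ := rfl

/-- The augmentation of the lower right entry. -/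
def sndAug : RZExtension k q →+* k := (RZAlgebra.aug q).toRingHom.comp (snd k q)

theorem fst_surjective : Function.Surjective (fst k q) := fun c => ⟨⟨c, 0, 0⟩, rfl⟩

theorem sndAug_surjective : Function.Surjective (sndAug k q) := fun c =>
  ⟨⟨0, 0, algebraMap k _ c⟩, (RZAlgebra.aug q).commutes c⟩

/-- The last three factors have a product with zero lower right entry, and left multiplication by a
matrix with zero upper left entry sees only that entry. -/
theorem mul_eq_zero {s t u v : RZExtension k q} (hs : fst k q s = 0) (ht : sndAug k q t = 0)
    (hu : sndAug k q u = 0) (hv : sndAug k q v = 0) : s * (t * (u * v)) = 0 := by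
  have h : t.a * (u.a * v.a) = 0 := RZAlgebra.mul_mul_eq_zero q ht hu hv
  have hs : s.c = 0 := hs
  ext1
  · rw [OnePointExtension.mul_c, hs, zero_mul]; rfl
  · rw [OnePointExtension.mul_m, OnePointExtension.mul_a, OnePointExtension.mul_a, h, hs, zero_smul,
      MulOpposite.op_zero, zero_smul, add_zero]; rfl
  · rw [OnePointExtension.mul_a, OnePointExtension.mul_a, OnePointExtension.mul_a, h, mul_zero]
    rfl

/-- The module of column vectors of length `3` on which `Λ(q)` acts by the matrices that
define `M(α)`. -/
def Column (_q _α : k) : Type u := Fin 3 → k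

namespace Column

variable (α : k)

instance : AddCommGroup (Column k q α) := inferInstanceAs (AddCommGroup (Fin 3 → k))

instance : Module (RZExtension k q) (Column k q α) :=
  Module.compHom (Fin 3 → k) ((RZModule.rep q α).toRingHom.comp (snd k q))

variable {k q α}

theorem smul_eq (s : RZExtension k q) (w : Column k q α) :
    s • w = ![RZAlgebra.aug q s.a * w 0 + (RZAlgebra.coords q s.a 1 * α +
      RZAlgebra.coords q s.a 2) * w 1 + RZAlgebra.coords q s.a 3 * w 2,
      RZAlgebra.aug q s.a * w 1, RZAlgebra.aug q s.a * w 2] :=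
  RZModule.rep_mulVec q α s.a w

end Column

/-- The dual of `Λ(q)`, as a left module over the one-point extension. -/
def DualLambda : Type u := DualModule k (RZAlgebra k q)

namespace DualLambda

instance : AddCommGroup (DualLambda k q) := inferInstanceAs (AddCommGroup (DualModule k _))

instance : FunLike (DualLambda k q) (RZAlgebra k q) k :=
  inferInstanceAs (FunLike (DualModule k (RZAlgebra k q)) (RZAlgebra k q) k)

instance : LinearMapClass (DualLambda k q) k (RZAlgebra k q) k :=
  inferInstanceAs (LinearMapClass (DualModule k (RZAlgebra k q)) k (RZAlgebra k q) k)

instance : Module (RZExtension k q) (DualLambda k q) :=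
  Module.compHom (DualModule k (RZAlgebra k q)) (snd k q)

variable {k q}

@[ext] theorem ext {f g : DualLambda k q} (h : ∀ a, f a = g a) : f = g := DFunLike.ext _ _ h

variable (k q)

/-- The lower row of matrices is a direct summand of the extension as a right module, so its dual is
a direct summand of the dual of the extension. -/
theorem injective : Module.Injective (RZExtension k q) (DualLambda k q) := by
  let i : DualLambda k q →ₗ[RZExtension k q] DualModule k (RZExtension k q) :=
    { toFun := fun f =>
        { toFun := fun s => f s.a
          map_add' := fun s t => map_add f s.a t.a
          map_smul' := fun c s => by
            rw [Algebra.smul_def]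
            refine (congrArg f (Algebra.smul_def c s.a).symm).trans (map_smul f c s.a) }
      map_add' := fun _ _ => rfl
      map_smul' := fun _ _ => rfl }
  let r : DualModule k (RZExtension k q) →ₗ[RZExtension k q] DualLambda k q :=
    { toFun := fun f =>
        { toFun := fun a => f ⟨0, 0, a⟩
          map_add' := fun a b => by
            rw [← map_add]
            congr 1
            ext1 <;> simp
          map_smul' := fun c a => by
            rw [← map_smul, Algebra.smul_def, Algebra.smul_def]
            congr 1
            ext1
            · exact (mul_zero c).symm
            · exact ((congrArg₂ (· + ·) (smul_zero c) (smul_zero (MulOpposite.op a))).trans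
                (add_zero 0)).symm
            · rfl }
      map_add' := fun _ _ => rfl
      map_smul' := fun s f => ext fun a => by
        change f (⟨0, 0, a⟩ * s) = f ⟨0, 0, a * s.a⟩
        congr 1
        ext1
        · exact zero_mul s.c
        · simp
        · rfl }
  exact DualModule.injective.of_retract i r fun _ => rfl

/-- The endomorphism `f ↦ f(x ·)`. -/
def precompX : DualLambda k q →ₗ[RZExtension k q] DualLambda k q where
  toFun f := LinearMap.comp (show RZAlgebra k q →ₗ[k] k from f)
    (LinearMap.mulLeft k (RZAlgebra.gen k q .x))
  map_add' _ _ := rfl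
  map_smul' s f := ext fun _ => congrArg f (mul_assoc (RZAlgebra.gen k q .x) _ s.a)

/-- The embedding of the column vectors as the functionals that vanish on `xΛ(q)`. -/
def ofColumn : Column k q 0 →ₗ[RZExtension k q] DualLambda k q where
  toFun w :=
    { toFun := fun a => (RZModule.rep q 0 a).mulVec w 0
      map_add' := fun a b => (congrArg (fun A => Matrix.mulVec A w 0) (map_add _ a b)).trans
        (congrFun (Matrix.add_mulVec _ _ w) 0)
      map_smul' := fun c a => (congrArg (fun A => Matrix.mulVec A w 0) (map_smul _ c a)).trans
        (congrFun (Matrix.smul_mulVec c _ w) 0) }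
  map_add' v w := ext fun _ => congrFun (Matrix.mulVec_add _ v w) 0
  map_smul' s w := ext fun a => (congrFun (Matrix.mulVec_mulVec w (RZModule.rep q 0 a)
    (RZModule.rep q 0 s.a)) 0).trans
      (congrArg (fun A => Matrix.mulVec A w 0) (map_mul (RZModule.rep q 0) a s.a).symm)

variable {k q}

theorem ofColumn_apply (w : Column k q 0) (a : RZAlgebra k q) :
    ofColumn k q w a = RZAlgebra.coords q a 0 * w 0 + RZAlgebra.coords q a 2 * w 1 +
      RZAlgebra.coords q a 3 * w 2 := by
  refine (congrFun (RZModule.rep_mulVec q 0 a w) 0).trans ?_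
  simp [RZAlgebra.coords_zero]

theorem ofColumn_injective : Function.Injective (ofColumn k q) := by
  intro v w h
  have h' : ∀ c : Fin 6 → k, c 0 * v 0 + c 2 * v 1 + c 3 * v 2 =
      c 0 * w 0 + c 2 * w 1 + c 3 * w 2 := fun c => by
    have := DFunLike.congr_fun h (RZAlgebra.ofCoords q c)
    rwa [ofColumn_apply, ofColumn_apply, RZAlgebra.coords_ofCoords] at this
  funext i
  fin_cases i
  · simpa using h' ![1, 0, 0, 0, 0, 0]
  · simpa using h' ![0, 0, 1, 0, 0, 0]
  · simpa using h' ![0, 0, 0, 1, 0, 0]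

theorem mem_ker_precompX {f : DualLambda k q} :
    f ∈ LinearMap.ker (precompX k q) ↔ ∀ a, f (RZAlgebra.gen k q .x * a) = 0 :=
  ⟨fun h a => DFunLike.congr_fun h a, fun h => ext h⟩

theorem range_precompX_le : LinearMap.range (precompX k q) ≤ LinearMap.ker (precompX k q) := by
  rintro _ ⟨f, rfl⟩
  refine mem_ker_precompX.2 fun a => ?_
  change f (RZAlgebra.gen k q .x * (RZAlgebra.gen k q .x * a)) = 0
  rw [← mul_assoc, RZAlgebra.xx, zero_mul, map_zero]

/-- A functional vanishing on `xΛ(q)` is determined by its values at `1, y, z`, which serve as the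
entries of the column. -/
theorem ker_precompX_le : LinearMap.ker (precompX k q) ≤ LinearMap.range (ofColumn k q) := by
  intro f hf
  rw [mem_ker_precompX] at hf
  refine ⟨(![f 1, f (RZAlgebra.gen k q .y), f (RZAlgebra.gen k q .z)] : Fin 3 → k),
    ext fun a => ?_⟩
  refine (ofColumn_apply _ a).trans ?_
  conv_rhs => rw [← RZAlgebra.ofCoords_coords q a, RZAlgebra.ofCoords_apply]
  have hx := hf 1
  rw [mul_one] at hx
  simp only [map_add, map_smul, hf, hx]
  simp

theorem range_ofColumn_le : LinearMap.range (ofColumn k q) ≤ LinearMap.range (precompX k q) := by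
  rintro _ ⟨w, rfl⟩
  -- Left multiplication by `x` carries `1, y, z` to the independent elements `x, xy, xz`, whose
  -- coordinates have indices `1, 4, 5`.
  let g : RZAlgebra k q →ₗ[k] k := (w 0 • LinearMap.proj 1 + w 1 • LinearMap.proj 4 +
    w 2 • LinearMap.proj 5) ∘ₗ RZAlgebra.coords q
  refine ⟨g, ext fun a => ?_⟩
  rw [ofColumn_apply]
  change w 0 * RZAlgebra.coords q (_ * a) 1 + w 1 * RZAlgebra.coords q (_ * a) 4 +
    w 2 * RZAlgebra.coords q (_ * a) 5 = _
  rw [RZAlgebra.coords_gen_mul, RZAlgebra.genEnd_x]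
  simp [mul_comm]

theorem ker_precompX : LinearMap.ker (precompX k q) = LinearMap.range (precompX k q) :=
  (ker_precompX_le.trans range_ofColumn_le).antisymm range_precompX_le

theorem range_ofColumn : LinearMap.range (ofColumn k q) = LinearMap.range (precompX k q) :=
  range_ofColumn_le.antisymm (range_precompX_le.trans ker_precompX_le)

end DualLambda

end RZExtension
end

noncomputable section

namespace RZExtension

variable {k : Type u} [Field k] {q : k}

/-! ### The simple module at the lower right entry -/

/-- The inclusion of the socle of `Column k q 0`. -/
def socle : OneDimensional (sndAug k q) →ₗ[RZExtension k q] Column k q 0 where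
  toFun t := (![t, 0, 0] : Fin 3 → k)
  map_add' s t := by
    funext i
    fin_cases i
    · rfl
    · exact (add_zero 0).symm
    · exact (add_zero 0).symm
  map_smul' s t := by
    refine Eq.trans ?_ (Column.smul_eq s (![t, 0, 0] : Fin 3 → k)).symm
    funext i
    fin_cases i
    · exact ((congrArg₂ (· + ·) (congrArg (RZAlgebra.aug q s.a * (show k from t) + ·)
        (mul_zero _)) (mul_zero _)).trans ((add_zero _).trans (add_zero _))).symm
    · exact (mul_zero _).symm
    · exact (mul_zero _).symm

/-- The endomorphisms of `Column k q 0` that map the top to the socle. -/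
def topToSocle (j : Fin 3) (hj : j ≠ 0) : Column k q 0 →ₗ[RZExtension k q] Column k q 0 where
  toFun w := (![w j, 0, 0] : Fin 3 → k)
  map_add' v w := by
    funext i
    fin_cases i
    · rfl
    · exact (add_zero 0).symm
    · exact (add_zero 0).symm
  map_smul' s w := by
    refine Eq.trans ?_ (Column.smul_eq s (![w j, 0, 0] : Fin 3 → k)).symm
    have h : (s • w) j = RZAlgebra.aug q s.a * w j := by
      rw [Column.smul_eq]
      fin_cases j
      · exact (hj rfl).elim
      · rfl
      · rfl
    rw [h]
    funext i
    fin_cases i <;> simp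

/-- An exact differential on a countable direct sum of copies of `Column k q 0`, which maps the
top isomorphically to the socle. -/
def sumTopToSocle : (ULift.{u} ℕ →₀ Column k q 0) →ₗ[RZExtension k q]
    (ULift.{u} ℕ →₀ Column k q 0) :=
  -- Each copy has a two-dimensional top and a one-dimensional socle; the bijection of `ℕ ⊔ ℕ` with
  -- `ℕ` by even and odd numbers matches all tops with all socles.
  Finsupp.lmapDomain _ _ (fun n => ⟨2 * n.down⟩) ∘ₗ
      Finsupp.mapRange.linearMap (topToSocle 1 (by decide)) +
    Finsupp.lmapDomain _ _ (fun n => ⟨2 * n.down + 1⟩) ∘ₗ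
      Finsupp.mapRange.linearMap (topToSocle 2 (by decide))

theorem double_injective : Function.Injective fun n : ULift.{u} ℕ => ULift.up.{u} (2 * n.down) :=
  fun m n h => ULift.ext _ _ (by have := congrArg ULift.down h; dsimp at this; omega)

theorem double_add_one_injective :
    Function.Injective fun n : ULift.{u} ℕ => ULift.up.{u} (2 * n.down + 1) :=
  fun m n h => ULift.ext _ _ (by have := congrArg ULift.down h; dsimp at this; omega)

theorem sumTopToSocle_double (w : ULift.{u} ℕ →₀ Column k q 0) (n : ULift.{u} ℕ) :
    sumTopToSocle w ⟨2 * n.down⟩ = topToSocle 1 (by decide) (w n) := by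
  refine (congrArg₂ (· + ·) (Finsupp.mapDomain_apply double_injective _ n)
    (Finsupp.mapDomain_of_notMem_range _ _ ?_)).trans (add_zero _)
  rintro ⟨m, hm⟩
  have := congrArg ULift.down hm
  dsimp at this
  omega

theorem sumTopToSocle_double_add_one (w : ULift.{u} ℕ →₀ Column k q 0) (n : ULift.{u} ℕ) :
    sumTopToSocle w ⟨2 * n.down + 1⟩ = topToSocle 2 (by decide) (w n) := by
  refine (congrArg₂ (· + ·) (Finsupp.mapDomain_of_notMem_range _ _ ?_)
    (Finsupp.mapDomain_apply double_add_one_injective _ n)).trans (zero_add _)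
  rintro ⟨m, hm⟩
  have := congrArg ULift.down hm
  dsimp at this
  omega

theorem double_cases (n : ULift.{u} ℕ) :
    ∃ m : ULift.{u} ℕ, n = ⟨2 * m.down⟩ ∨ n = ⟨2 * m.down + 1⟩ := by
  obtain ⟨m, h⟩ := Nat.even_or_odd' n.down
  exact ⟨⟨m⟩, h.imp (ULift.ext _ _) (ULift.ext _ _)⟩

theorem mem_ker_sumTopToSocle {w : ULift.{u} ℕ →₀ Column k q 0} :
    w ∈ LinearMap.ker sumTopToSocle ↔ ∀ n, w n 1 = 0 ∧ w n 2 = 0 := by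
  constructor
  · intro h n
    have h : sumTopToSocle w = 0 := h
    have h1 := sumTopToSocle_double w n
    have h2 := sumTopToSocle_double_add_one w n
    rw [h] at h1 h2
    exact ⟨(congrFun h1 0).symm, (congrFun h2 0).symm⟩
  · intro h
    refine Finsupp.ext fun n => ?_
    obtain ⟨m, rfl | rfl⟩ := double_cases n
    · refine (sumTopToSocle_double w m).trans ?_
      funext i
      fin_cases i
      · exact (h m).1
      · rfl
      · rfl
    · refine (sumTopToSocle_double_add_one w m).trans ?_
      funext i
      fin_cases i
      · exact (h m).2
      · rfl
      · rfl

theorem mem_range_sumTopToSocle {w : ULift.{u} ℕ →₀ Column k q 0} :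
    w ∈ LinearMap.range sumTopToSocle ↔ ∀ n, w n 1 = 0 ∧ w n 2 = 0 := by
  constructor
  · rintro ⟨v, rfl⟩ n
    obtain ⟨m, rfl | rfl⟩ := double_cases n
    · rw [sumTopToSocle_double]
      exact ⟨rfl, rfl⟩
    · rw [sumTopToSocle_double_add_one]
      exact ⟨rfl, rfl⟩
  · intro h
    let f : Column k q 0 → Column k q 0 := fun v => (![0, v 0, 0] : Fin 3 → k)
    let g : Column k q 0 → Column k q 0 := fun v => (![0, 0, v 0] : Fin 3 → k)
    have hf : f 0 = 0 := by
      funext i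
      fin_cases i <;> rfl
    have hg : g 0 = 0 := by
      funext i
      fin_cases i <;> rfl
    -- The socle entries at indices `2m` and `2m + 1` become the two top entries at index `m`.
    let v := Finsupp.mapRange f hf (w.comapDomain _ double_injective.injOn) +
      Finsupp.mapRange g hg (w.comapDomain _ double_add_one_injective.injOn)
    refine ⟨v, Finsupp.ext fun n => ?_⟩
    obtain ⟨m, rfl | rfl⟩ := double_cases n
    · refine (sumTopToSocle_double v m).trans ?_
      funext i
      fin_cases i
      · exact add_zero (w ⟨2 * m.down⟩ 0)
      · exact (h _).1.symm
      · exact (h _).2.symm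
    · refine (sumTopToSocle_double_add_one v m).trans ?_
      funext i
      fin_cases i
      · exact zero_add (w ⟨2 * m.down + 1⟩ 0)
      · exact (h _).1.symm
      · exact (h _).2.symm

theorem mem_range_mapRange_socle {w : ULift.{u} ℕ →₀ Column k q 0} :
    w ∈ LinearMap.range (Finsupp.mapRange.linearMap (α := ULift.{u} ℕ) (socle (k := k) (q := q))) ↔
      ∀ n, w n 1 = 0 ∧ w n 2 = 0 := by
  constructor
  · rintro ⟨v, rfl⟩ n
    exact ⟨rfl, rfl⟩
  · intro h
    let f : Column k q 0 → OneDimensional (sndAug k q) := fun v => v 0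
    refine ⟨Finsupp.mapRange f rfl w, Finsupp.ext fun n => ?_⟩
    funext i
    fin_cases i
    · rfl
    · exact (h n).1.symm
    · exact (h n).2.symm

/-! ### The injective module at the upper left entry -/

/-- The pairing of `M(q)` with its dual. -/
def pairing (m : RZModule k q q) (w : Column k q q) : k :=
  dotProduct (m : Fin 3 → k) (w : Fin 3 → k)

theorem pairing_add (m : RZModule k q q) (v w : Column k q q) :
    pairing m (v + w) = pairing m v + pairing m w := dotProduct_add _ _ _

theorem add_pairing (m n : RZModule k q q) (w : Column k q q) :
    pairing (m + n) w = pairing m w + pairing n w := add_dotProduct _ _ _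

theorem pairing_zero (m : RZModule k q q) : pairing m 0 = 0 := dotProduct_zero _

theorem zero_pairing (w : Column k q q) : pairing 0 w = 0 := zero_dotProduct _

theorem smul_pairing (c : k) (m : RZModule k q q) (w : Column k q q) :
    pairing (c • m) w = c * pairing m w := smul_dotProduct _ _ _

/-- This adjunction identifies `Column k q q` with the dual of `M(q)`, and it is what makes the
action on `RowDual k q` associative. -/
theorem op_smul_pairing (s : RZExtension k q) (m : RZModule k q q) (w : Column k q q) :
    pairing (MulOpposite.op s.a • m) w = pairing m (s • w) :=
  (Matrix.dotProduct_mulVec _ _ _).symm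

variable (k q) in
/-- The basis vectors of `M(q)`. -/
def rowBasis (i : Fin 3) : RZModule k q q := fun j => if i = j then 1 else 0

theorem rowBasis_pairing (i : Fin 3) (w : Column k q q) : pairing (rowBasis k q i) w = w i := by
  simp only [pairing, dotProduct, rowBasis, ite_mul, one_mul, zero_mul]
  exact Fintype.sum_ite_eq i w

variable (k q)

/-- The dual of the row of the one-point extension that contains `k` and `M(q)`. -/
def RowDual : Type u := k × Column k q q

namespace RowDual

instance : AddCommGroup (RowDual k q) := inferInstanceAs (AddCommGroup (k × Column k q q))

instance : Module (RZExtension k q) (RowDual k q) where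
  smul s x := (s.c * x.1 + pairing s.m x.2, s • x.2)
  one_smul x := Prod.ext (by
    change 1 * x.1 + pairing 0 x.2 = x.1
    rw [zero_pairing, one_mul, add_zero]) (one_smul _ x.2)
  mul_smul s t x := Prod.ext (by
    change s.c * t.c * x.1 + pairing (s.c • t.m + MulOpposite.op t.a • s.m) x.2 =
      s.c * (t.c * x.1 + pairing t.m x.2) + pairing s.m (t • x.2)
    rw [add_pairing, smul_pairing, op_smul_pairing]
    ring) (mul_smul s t x.2)
  smul_zero s := Prod.ext (by
    change s.c * 0 + pairing s.m 0 = 0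
    rw [pairing_zero, mul_zero, add_zero]) (smul_zero s)
  smul_add s x y := Prod.ext (by
    change s.c * (x.1 + y.1) + pairing s.m (x.2 + y.2) =
      s.c * x.1 + pairing s.m x.2 + (s.c * y.1 + pairing s.m y.2)
    rw [pairing_add]
    ring) (smul_add s x.2 y.2)
  add_smul s t x := Prod.ext (by
    change (s.c + t.c) * x.1 + pairing (s.m + t.m) x.2 =
      s.c * x.1 + pairing s.m x.2 + (t.c * x.1 + pairing t.m x.2)
    rw [add_pairing]
    ring) (add_smul s t x.2)
  zero_smul x := Prod.ext (by
    change 0 * x.1 + pairing 0 x.2 = 0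
    rw [zero_pairing, zero_mul, add_zero]) (zero_smul _ x.2)

variable {k q}

/-- The module `RowDual k q` as a submodule of the dual of the one-point extension. -/
def toDualModule : RowDual k q →ₗ[RZExtension k q] DualModule k (RZExtension k q) where
  toFun x :=
    { toFun := fun s => (s • x).1
      map_add' := fun s t => congrArg Prod.fst (add_smul s t x)
      map_smul' := fun c s => by
        rw [Algebra.smul_def, mul_smul]
        change c * (s • x).1 + pairing 0 _ = _
        rw [zero_pairing, add_zero]
        rfl }
  map_add' x y := DualModule.ext fun s => congrArg Prod.fst (smul_add s x y)
  map_smul' t x := DualModule.ext fun s => congrArg Prod.fst (mul_smul s t x).symm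

/-- The restriction of a functional on the one-point extension to the dual of `M(q)`. -/
def column (f : DualModule k (RZExtension k q)) : Column k q q :=
  fun i => f ⟨0, rowBasis k q i, 0⟩

theorem dualModule_apply (f : DualModule k (RZExtension k q)) (c : k) (m : RZModule k q q) :
    f ⟨c, m, 0⟩ = c * f ⟨1, 0, 0⟩ + pairing m (column f) := by
  let ι : (Fin 3 → k) →ₗ[k] RZExtension k q :=
    { toFun := fun m => ⟨0, m, 0⟩
      map_add' := fun m n => by
        ext1
        · exact (add_zero 0).symm
        · rfl
        · exact (add_zero 0).symm
      map_smul' := fun c m => by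
        rw [Algebra.smul_def]
        ext1
        · exact (mul_zero c).symm
        · exact ((congrArg (c • m + ·) (smul_zero (A := RZModule k q q)
            (MulOpposite.op (0 : RZAlgebra k q)))).trans (add_zero _)).symm
        · exact (mul_zero _).symm }
  have h : (⟨c, m, 0⟩ : RZExtension k q) = c • ⟨1, 0, 0⟩ + ι m := by
    rw [Algebra.smul_def]
    ext1
    · exact ((congrArg (· + 0) (mul_one c)).trans (add_zero c)).symm
    · refine (Eq.trans (congrArg (· + m) ?_) (zero_add m)).symm
      exact (congrArg₂ (· + ·) (smul_zero c)
        (smul_zero (MulOpposite.op (0 : RZAlgebra k q)))).trans (add_zero 0)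
    · exact ((congrArg (· + 0) (mul_zero _)).trans (add_zero 0)).symm
  rw [h, map_add, map_smul]
  refine congrArg (c • f ⟨1, 0, 0⟩ + ·) ?_
  exact LinearMap.pi_apply_eq_sum_univ ((show RZExtension k q →ₗ[k] k from f) ∘ₗ ι) m

/-- A retraction of `toDualModule`. -/
def ofDualModule : DualModule k (RZExtension k q) →ₗ[RZExtension k q] RowDual k q where
  toFun f := (f ⟨1, 0, 0⟩, column f)
  map_add' _ _ := rfl
  map_smul' s f := by
    have h : ∀ t : RZExtension k q, t.a = 0 → f (t * s) = t.c * (s.c * f ⟨1, 0, 0⟩ +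
        pairing s.m (column f)) + pairing t.m (s • column f) := fun t ht => by
      have : t * s = ⟨t.c * s.c, t.c • s.m + MulOpposite.op s.a • t.m, 0⟩ := by
        ext1
        · rfl
        · rfl
        · rw [OnePointExtension.mul_a, ht, zero_mul]
      rw [this, dualModule_apply, add_pairing, smul_pairing, op_smul_pairing]
      ring
    refine Prod.ext ?_ (funext fun i => ?_)
    · refine (h ⟨1, 0, 0⟩ rfl).trans ?_
      rw [zero_pairing, add_zero, one_mul]
      rfl
    · refine (h ⟨0, rowBasis k q i, 0⟩ rfl).trans ?_
      rw [rowBasis_pairing, zero_mul, zero_add]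
      rfl

variable (k q)

/-- The upper row `(k, M(q))` is the other direct summand of the extension as a right module, and
`RowDual k q` is its dual. -/
theorem injective : Module.Injective (RZExtension k q) (RowDual k q) := by
  refine DualModule.injective.of_retract toDualModule ofDualModule fun x => ?_
  refine Prod.ext ?_ (funext fun i => ?_)
  · change 1 * x.1 + pairing 0 x.2 = x.1
    rw [zero_pairing, one_mul, add_zero]
  · change 0 * x.1 + pairing (rowBasis k q i) x.2 = x.2 i
    rw [rowBasis_pairing, zero_mul, zero_add]

/-- The inclusion of the socle of `RowDual k q`. -/
def inl : OneDimensional (fst k q) →ₗ[RZExtension k q] RowDual k q where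
  toFun t := ((t : k), 0)
  map_add' s t := Prod.ext rfl (add_zero 0).symm
  map_smul' s t := Prod.ext (by
    refine ((congrArg (s.c * (show k from t) + ·) (pairing_zero s.m)).trans (add_zero _)).symm)
    (smul_zero s).symm

/-- The projection from `RowDual k q` to the dual of `M(q)`. -/
def snd : RowDual k q →ₗ[RZExtension k q] Column k q q where
  toFun x := x.2
  map_add' _ _ := rfl
  map_smul' _ _ := rfl

end RowDual

/-! ### All modules -/

variable {k q} {C : ∀ (M : Type u) [AddCommGroup M] [Module (RZExtension k q) M], Prop}

theorem class_column_zero (hC : IsLocalizingModuleClass (RZExtension k q) C) :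
    C (Column k q 0) :=
  hC.of_range (DualLambda.precompX k q) DualLambda.ker_precompX (DualLambda.ofColumn k q)
    DualLambda.ofColumn_injective DualLambda.range_ofColumn
    (hC.injective _ (DualLambda.injective k q))

/-- The socle of the countable sum of copies of `Column k q 0` is both kernel and image of
`sumTopToSocle`, and it is a countable sum of copies of this simple module. -/
theorem class_sndAug (hC : IsLocalizingModuleClass (RZExtension k q) C) :
    C (OneDimensional (sndAug k q)) :=
  hC.of_finsupp (hC.of_range sumTopToSocle
    (SetLike.ext fun _ => mem_ker_sumTopToSocle.trans mem_range_sumTopToSocle.symm)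
    (Finsupp.mapRange.linearMap socle)
    (Finsupp.mapRange_injective _ (map_zero _) fun _ _ h => congrFun h 0)
    (SetLike.ext fun _ => mem_range_mapRange_socle.trans mem_range_sumTopToSocle.symm)
    (hC.finsupp _ (class_column_zero hC)))

theorem class_of_smul_smul (hC : IsLocalizingModuleClass (RZExtension k q) C) (M : Type u)
    [AddCommGroup M] [Module (RZExtension k q) M]
    (hM : ∀ r s, sndAug k q r = 0 → sndAug k q s = 0 → ∀ m : M, r • s • m = 0) : C M :=
  hC.of_forall_ker_mul_smul (sndAug_surjective k q) (class_sndAug hC)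
    (fun M _ _ => hC.of_forall_ker_smul (sndAug_surjective k q) (class_sndAug hC) M) M hM

/-- This is the kernel of the map from the injective `RowDual k q` onto the dual of `M(q)`, which is
annihilated by products of two elements of the kernel of `sndAug`. -/
theorem class_fst (hC : IsLocalizingModuleClass (RZExtension k q) C) :
    C (OneDimensional (fst k q)) := by
  refine hC.left (RowDual.inl k q) (RowDual.snd k q) (fun _ _ h => congrArg Prod.fst h)
    (fun x => ⟨fun h => ⟨x.1, Prod.ext rfl (Eq.symm h)⟩, ?_⟩) (fun w => ⟨((0 : k), w), rfl⟩)
    (hC.injective _ (RowDual.injective k q)) (class_of_smul_smul hC _ fun r s hr hs w => ?_)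
  · rintro ⟨t, rfl⟩
    rfl
  · have hr : RZAlgebra.aug q r.a = 0 := hr
    have hs : RZAlgebra.aug q s.a = 0 := hs
    rw [Column.smul_eq, Column.smul_eq, hr, hs]
    funext i
    fin_cases i <;> simp <;> rfl

/-- By `mul_eq_zero` every module has a filtration with four layers: the lowest is annihilated by
the kernel of `fst`, the other three by the kernel of `sndAug`. -/
theorem class_of_isLocalizingModuleClass (hC : IsLocalizingModuleClass (RZExtension k q) C)
    (M : Type u) [AddCommGroup M] [Module (RZExtension k q) M] : C M := by
  refine hC.of_forall_ker_mul_smul (fst_surjective k q) (class_fst hC)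
    (K := fun r => ∃ s t u, sndAug k q s = 0 ∧ sndAug k q t = 0 ∧ sndAug k q u = 0 ∧
      r = s * (t * u)) (fun N _ _ hN => ?_) M ?_
  · refine hC.of_forall_ker_mul_smul (sndAug_surjective k q) (class_sndAug hC)
      (K := fun r => ∃ s t, sndAug k q s = 0 ∧ sndAug k q t = 0 ∧ r = s * t)
      (fun N _ _ hN => class_of_smul_smul hC N fun r s hr hs m => ?_) N ?_
    · rw [← mul_smul]
      exact hN _ ⟨r, s, hr, hs, rfl⟩ m
    · rintro r _ hr ⟨s, t, hs, ht, rfl⟩ m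
      rw [← mul_smul]
      exact hN _ ⟨r, s, t, hr, hs, ht, rfl⟩ m
  · rintro r _ hr ⟨s, t, u, hs, ht, hu, rfl⟩ m
    rw [← mul_smul, mul_eq_zero k q hr hs ht hu, zero_smul]

end RZExtension

end

theorem mainTheorem5 {k : Type u} [Field k] (q : k) (hq0 : q ≠ 0) (hq : ¬ IsOfFinOrder q)
    [HasDerivedCategory.{w} (ModuleCat.{u}
      ((OnePointExtension k (RZAlgebra k q) (RZModule k q q))ᵐᵒᵖ)ᵐᵒᵖ)] :
    InjectivesGenerate.{w}
      ((OnePointExtension k (RZAlgebra k q) (RZModule k q q))ᵐᵒᵖ) := by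
  refine funext fun X => eq_top_iff.2 fun _ P hP hI => ?_
  exact IsLocalizingSubcategory.prop_of_forall_isLocalizingModuleClass
    (RingEquiv.opOp (RZExtension k q)).symm P
    (fun M hM => hI _ (ObjectProperty.prop_map_obj _ _ hM))
    (fun C hC => RZExtension.class_of_isLocalizingModuleClass hC) X
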